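/- Let $S$ be a subsemigroup, containing $0$, of an additive abelian torsion-free group $G$, and assume that $S$ contains no nontrivial group, i.e. $S\cap(-S)=\{0\}$. An isometric representation of $S$ is a map $a\mapsto V_a$ from $S$ to the isometries of a nonzero complex Hilbert space with $V_{a+b}=V_aV_b$ for all $a,b\in S$. Let $C^*(S)$ be the universal $C^*$-algebra of isometric representations of $S$, i.e. the $C^*$-algebra generated by the direct sum of all isometric representations of $S$. Let $C^*_{red}(S)$ be the reduced semigroup $C^*$-algebra, i.e. the $C^*$-algebra of operators on $\ell^2(S)$ generated by the isometries $V_a$, $a\in S$, where $(V_af)(b)=f(c)$ if $b=a+c$ for some $c\in S$, and $(V_af)(b)=0$ otherwise. Then the $C^*$-algebras $C^*(S)$ and $C^*_{red}(S)$ are $*$-isomorphic if and only if $S$ is totally ordered, i.e. $S$ is a positive cone of some group: there is a subgroup $H\subseteq G$ with $H=S\cup(-S)$ and $S\cap(-S)=\{0\}$. In particular, for $S=\mathbb{Z}^+\setminus\{1\}=\{0,2,3,4,\dots\}\subset\mathbb{Z}$ the $C^*$-algebras $C^*(S)$ and $C^*_{red}(S)$ are not isomorphic. -/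

import Mathlib

open scoped ENNReal

universe u

namespace SemigroupCStar

variable {G : Type u} [AddCommGroup G]

/-- `S` does not contain a nontrivial group: `S ∩ (-S) = {0}`. -/
def ContainsNoGroup (S : AddSubmonoid G) : Prop :=
  (S : Set G) ∩ -(S : Set G) = {0}

/-- `S` is totally ordered, that is, `S` is a positive cone of some group `H` (a subgroup of the
ambient group): `H = S ∪ (-S)` and `S ∩ (-S) = {0}`. -/
def IsTotallyOrdered (S : AddSubmonoid G) : Prop :=
  ∃ H : AddSubgroup G, (H : Set G) = (S : Set G) ∪ -(S : Set G) ∧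
    (S : Set G) ∩ -(S : Set G) = {0}

/-- An isometric representation of `S` on a nonzero complex Hilbert space: a map `a ↦ V a` into
the isometries of the space with `V (a + b) = V a V b`. (Then `V 0 = 1` automatically.) -/
structure IsometricRep (S : AddSubmonoid G) where
  space : Type u
  [normedAddCommGroup : NormedAddCommGroup space]
  [innerProductSpace : InnerProductSpace ℂ space]
  [completeSpace : CompleteSpace space]
  [nontrivial : Nontrivial space]
  V : S → space →L[ℂ] space
  isometry : ∀ a, Isometry (V a)
  map_add : ∀ a b, V (a + b) = V a * V b

attribute [instance] IsometricRep.normedAddCommGroup IsometricRep.innerProductSpace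
  IsometricRep.completeSpace IsometricRep.nontrivial

/-- The C*-algebra generated by a family `v` of elements of a C*-algebra `A`:
the norm closure of the unital *-subalgebra generated by them. -/
noncomputable def generatedCStar {ι : Type*} {A : Type*} [NormedRing A] [StarRing A]
    [CStarRing A] [NormedAlgebra ℂ A] [StarModule ℂ A] (v : ι → A) : StarSubalgebra ℂ A :=
  (StarAlgebra.adjoin ℂ (Set.range v)).topologicalClosure

section Universal

variable (S : AddSubmonoid G)

/-- The C*-algebra of all bounded families `(T π)`, indexed by the isometric representations `π`
of `S`, with `T π` a bounded operator on the space of `π`, and with the supremum norm. -/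
abbrev RepProduct : Type (u + 1) :=
  lp (fun π : IsometricRep S => π.space →L[ℂ] π.space) ∞

/-- The direct sum of all isometric representations of `S`. -/
noncomputable def universalIsometry (a : S) : RepProduct S :=
  ⟨fun π => π.V a, by
    refine ⟨1, ?_⟩
    rintro _ ⟨π, rfl⟩
    refine ContinuousLinearMap.opNorm_le_bound _ zero_le_one fun x => ?_
    have h := (AddMonoidHomClass.isometry_iff_norm (π.V a)).1 (π.isometry a) x
    rw [h, one_mul]⟩

/-- The universal C*-algebra `C*(S)`, generated by the direct sum of all isometric
representations of `S`. -/
abbrev UniversalCStar : Type (u + 1) := generatedCStar (universalIsometry S)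

end Universal

section Reduced

variable (S : AddSubmonoid G)

/-- The Hilbert space `ℓ²(S)`. -/
abbrev L2 : Type u := lp (fun _ : S => ℂ) 2

variable {S}

theorem add_left_inj' (a : S) : Function.Injective fun c : S => a + c :=
  fun _ _ h => add_left_cancel h

theorem norm_rpow_extend (a : S) (f : S → ℂ) :
    (fun b => ‖Function.extend (fun c : S => a + c) f 0 b‖ ^ (2 : ℝ≥0∞).toReal) =
      Function.extend (fun c : S => a + c) (fun c => ‖f c‖ ^ (2 : ℝ≥0∞).toReal) 0 := by
  funext b
  by_cases h : ∃ c : S, a + c = b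
  · obtain ⟨c, rfl⟩ := h
    rw [(add_left_inj' a).extend_apply f 0 c,
      (add_left_inj' a).extend_apply (fun c => ‖f c‖ ^ (2 : ℝ≥0∞).toReal) 0 c]
  · rw [Function.extend_apply' _ _ _ h, Function.extend_apply' _ _ _ h]
    simp

theorem hasSum_shift (a : S) (f : L2 S) :
    HasSum (fun b => ‖Function.extend (fun c : S => a + c) f 0 b‖ ^ (2 : ℝ≥0∞).toReal)
      (‖f‖ ^ (2 : ℝ≥0∞).toReal) := by
  rw [norm_rpow_extend, hasSum_extend_zero (add_left_inj' a)]
  exact lp.hasSum_norm (by norm_num) f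

/-- The operator `V_a` on `ℓ²(S)`: `(V_a f)(b) = f(c)` if `b = a + c` for some `c` in `S`,
and `(V_a f)(b) = 0` otherwise. -/
noncomputable def regularShift (a : S) : L2 S →ₗᵢ[ℂ] L2 S where
  toFun f := ⟨Function.extend (fun c : S => a + c) f 0,
    memℓp_gen (hasSum_shift a f).summable⟩
  map_add' f g := by
    ext b
    change Function.extend (fun c : S => a + c) (fun c => f c + g c) 0 b =
      Function.extend (fun c : S => a + c) f 0 b + Function.extend (fun c : S => a + c) g 0 b
    by_cases h : ∃ c : S, a + c = b
    · obtain ⟨c, rfl⟩ := h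
      rw [(add_left_inj' a).extend_apply (fun c => f c + g c) 0 c,
        (add_left_inj' a).extend_apply f 0 c, (add_left_inj' a).extend_apply g 0 c]
    · rw [Function.extend_apply' _ _ _ h, Function.extend_apply' _ _ _ h,
        Function.extend_apply' _ _ _ h]
      simp
  map_smul' z f := by
    ext b
    change Function.extend (fun c : S => a + c) (fun c => z * f c) 0 b =
      z * Function.extend (fun c : S => a + c) f 0 b
    by_cases h : ∃ c : S, a + c = b
    · obtain ⟨c, rfl⟩ := h
      rw [(add_left_inj' a).extend_apply (fun c => z * f c) 0 c,
        (add_left_inj' a).extend_apply f 0 c]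
    · rw [Function.extend_apply' _ _ _ h, Function.extend_apply' _ _ _ h]
      simp
  norm_map' f := by
    have hp : (0 : ℝ) < (2 : ℝ≥0∞).toReal := by norm_num
    have h := lp.hasSum_norm hp (⟨Function.extend (fun c : S => a + c) f 0,
        memℓp_gen (hasSum_shift a f).summable⟩ : L2 S)
    exact (Real.rpow_left_inj (norm_nonneg _) (norm_nonneg _) hp.ne').1
      (h.unique (hasSum_shift a f))

theorem regularShift_apply_add (a c : S) (f : L2 S) : regularShift a f (a + c) = f c :=
  (add_left_inj' a).extend_apply f 0 c

theorem regularShift_apply_of_not (a b : S) (f : L2 S) (h : ¬ ∃ c : S, a + c = b) :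
    regularShift a f b = 0 :=
  Function.extend_apply' _ _ _ h

variable (S)

/-- The reduced semigroup C*-algebra `C*_red(S)`, generated by the regular isometric
representation of `S` on `ℓ²(S)`. -/
abbrev ReducedCStar : Type u :=
  generatedCStar fun a : S => (regularShift a).toContinuousLinearMap

end Reduced

/-- The semigroup `ℤ⁺ \ {1} = {0, 2, 3, 4, …}`. -/
def natWithoutOne : AddSubmonoid ℤ where
  carrier := {n | 0 ≤ n ∧ n ≠ 1}
  zero_mem' := by simp
  add_mem' := by
    intro a b ha hb
    simp only [Set.mem_ofPred_eq] at *
    omega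

end SemigroupCStar

/-!
**An isomorphism forces a total order.** An isomorphism turns every isometric representation of
`S` into a representation of the reduced C*-algebra, so it suffices to find a property of all
representations of the reduced algebra which some isometric representation lacks. The property is a
positive unital bimodule map onto the commutant. The reduced algebra contains the diagonal unitaries
`1 - 2 V_a V_a^*`, which commute with each other and can be transported along the `V_a`; averaging
the operators of the representation space first over the diagonal unitaries and then over the images
of the `V_a` gives such a map (`exists_expectation`). Both averages exist because cancellative
commutative monoids satisfy the Følner condition: sums of boundedly many elements of a finite set
grow polynomially (`exists_folner`).

If `x` and `y` are incomparable, put `a = x - y`. For a group `Γ` and `s, t ∈ Γ` with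
`s² = t³ = 1`, let `S` act by translations on the closed span of the vectors
`δ_{(p,0,γ)} + δ_{(p+a,0,γs)} + δ_{(p,1,γ)} + δ_{(p+a,1,γt)}`, `p ∈ S`. The vectors with `p = 0`
span the common kernel of the adjoints of the shifts, and the compression of `V_y^* V_x` to it is a
multiple of the sum of the right translations by `s⁻¹` and `t⁻¹`. Hence the diagonal matrix
coefficients of operators in the commutant are invariant under right multiplication by `s` and by
`t` (`inner_commutant_invariant`), while the left translations by `Γ` lie in the commutant. Applying
the bimodule map to the compressions of multiplication by indicator functions therefore gives a mean
on `Γ` invariant under `s` and `t`. For a free product with `s` and `t` in different factors there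
is none, by ping-pong (`no_invariant_measure`).

**A total order gives an isomorphism.** The products `V_a V_b^*` span the star algebra generated by
the isometries, since `V_b^* V_c` is a shift or the adjoint of a shift. The range projections of a
representation decrease along the order; cutting a finite chain of them into differences, and
averaging over a Følner set, compares the matrix coefficients of `∑ c_i V_{a_i} V_{b_i}^*` in any
isometric representation with the norm of the same sum in the regular representation
(`norm_inner_sum_monomial_le`). So evaluation at the regular representation is isometric, and it
maps the universal algebra onto the reduced one.

The semigroup `{0, 2, 3, …}` is not totally ordered because `1 = 3 - 2` is neither in it nor in its
negative.
-/

namespace SemigroupCStar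

/-! ### Amenability of cancellative commutative monoids -/

section Folner

variable {M : Type*} [AddCancelCommMonoid M]

open Classical in
/-- The set of all sums `∑ e b • b` over `b ∈ A` with coefficients `0 ≤ e b ≤ n`. -/
noncomputable def sumBox (A : Finset M) (n : ℕ) : Finset M :=
  (Fintype.piFinset fun _ : A => Finset.range (n + 1)).image fun e => ∑ b : A, e b • (b : M)

theorem sumBox_nonempty (A : Finset M) (n : ℕ) : (sumBox A n).Nonempty := by
  classical
  refine ⟨∑ b : A, 0 • (b : M), Finset.mem_image.2 ⟨fun _ => 0, ?_, rfl⟩⟩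
  simp

theorem card_sumBox_le (A : Finset M) (n : ℕ) : (sumBox A n).card ≤ (n + 1) ^ A.card := by
  classical
  refine Finset.card_image_le.trans ?_
  simp

theorem add_mem_sumBox {A : Finset M} {n : ℕ} {a x : M} (ha : a ∈ A) (hx : x ∈ sumBox A n) :
    x + a ∈ sumBox A (n + 1) := by
  classical
  obtain ⟨e, he, rfl⟩ := Finset.mem_image.1 hx
  refine Finset.mem_image.2 ⟨fun b => e b + if b = ⟨a, ha⟩ then 1 else 0, ?_, ?_⟩
  · simp only [Fintype.mem_piFinset, Finset.mem_range] at he ⊢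
    intro b
    have := he b
    split_ifs <;> omega
  · simp [add_smul, Finset.sum_add_distrib, ite_smul]

/-- Polynomial growth forces the boxes to grow by a factor close to `1` at some stage. -/
theorem exists_card_sumBox_succ_le (A : Finset M) {ε : ℝ} (hε : 0 < ε) :
    ∃ n, ((sumBox A (n + 1)).card : ℝ) ≤ (1 + ε) * (sumBox A n).card := by
  by_contra! h
  have hgrow : ∀ n, (1 + ε) ^ n ≤ ((sumBox A n).card : ℝ) := by
    intro n
    induction n with
    | zero => simpa using (sumBox_nonempty A 0)
    | succ n ih =>
      rw [pow_succ, mul_comm]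
      exact (mul_le_mul_of_nonneg_left ih (by positivity)).trans (h n).le
  have ht := (tendsto_pow_const_div_const_pow_of_one_lt A.card
    (show (1 : ℝ) < 1 + ε by linarith)).comp (Filter.tendsto_add_atTop_nat 1)
  have hev := ht.eventually (gt_mem_nhds (show (0 : ℝ) < (1 + ε)⁻¹ by positivity))
  obtain ⟨n, hn⟩ := hev.exists
  have h1 : ((n : ℝ) + 1) ^ A.card < (1 + ε) ^ n := by
    have hn' : ((n : ℝ) + 1) ^ A.card / (1 + ε) ^ (n + 1) < (1 + ε)⁻¹ := by
      simpa using hn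
    rw [div_lt_iff₀ (by positivity), pow_succ] at hn'
    rwa [mul_comm ((1 + ε) ^ n), inv_mul_cancel_left₀ (by positivity)] at hn'
  have h2 : ((sumBox A n).card : ℝ) ≤ ((n : ℝ) + 1) ^ A.card := by
    exact_mod_cast card_sumBox_le A n
  linarith [hgrow n]

open Classical in
/-- A cancellative commutative monoid satisfies the Følner condition. -/
theorem exists_folner (A : Finset M) {ε : ℝ} (hε : 0 < ε) :
    ∃ F : Finset M, F.Nonempty ∧ ∀ a ∈ A, ∀ b ∈ A,
      (1 - ε) * F.card ≤ ((F.image (· + a) ∩ F.image (· + b)).card : ℝ) := by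
  obtain ⟨n, hn⟩ := exists_card_sumBox_succ_le A hε
  refine ⟨sumBox A n, sumBox_nonempty A n, fun a ha b hb => ?_⟩
  have hsub : ∀ c ∈ A, (sumBox A n).image (· + c) ⊆ sumBox A (n + 1) := by
    intro c hc x hx
    obtain ⟨y, hy, rfl⟩ := Finset.mem_image.1 hx
    exact add_mem_sumBox hc hy
  have hcard : ∀ c : M, ((sumBox A n).image (· + c)).card = (sumBox A n).card := fun c =>
    Finset.card_image_of_injective _ (add_left_injective c)
  have h1 := Finset.card_union_add_card_inter ((sumBox A n).image (· + a))
    ((sumBox A n).image (· + b))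
  have h2 := Finset.card_le_card (Finset.union_subset (hsub a ha) (hsub b hb))
  rw [hcard, hcard] at h1
  have h1' : (((sumBox A n).image (· + a) ∪ (sumBox A n).image (· + b)).card : ℝ) +
      ((sumBox A n).image (· + a) ∩ (sumBox A n).image (· + b)).card =
      (sumBox A n).card + (sumBox A n).card := by exact_mod_cast h1
  have h2' : (((sumBox A n).image (· + a) ∪ (sumBox A n).image (· + b)).card : ℝ) ≤
    (sumBox A (n + 1)).card := by exact_mod_cast h2
  linarith

/-- An invariant mean on a commutative monoid: a functional on complex functions, meaningful on
bounded functions only, which is linear, contractive, unital, positive and translation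
invariant there. -/
structure InvariantMean (M : Type*) [AddCommMonoid M] where
  toFun : (M → ℂ) → ℂ
  map_add : ∀ f g C D, (∀ k, ‖f k‖ ≤ C) → (∀ k, ‖g k‖ ≤ D) →
    toFun (fun k => f k + g k) = toFun f + toFun g
  map_mul : ∀ (c : ℂ) f C, (∀ k, ‖f k‖ ≤ C) → toFun (fun k => c * f k) = c * toFun f
  norm_le : ∀ f C, (∀ k, ‖f k‖ ≤ C) → ‖toFun f‖ ≤ C
  map_const : ∀ c, toFun (fun _ => c) = c
  re_nonneg : ∀ f C, (∀ k, ‖f k‖ ≤ C) → (∀ k, 0 ≤ (f k).re) → 0 ≤ (toFun f).re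
  map_translate : ∀ f C a, (∀ k, ‖f k‖ ≤ C) → toFun (fun k => f (k + a)) = toFun f

/-- The average of `f` over the finite set `F`. -/
noncomputable def average {M : Type*} (F : Finset M) (f : M → ℂ) : ℂ :=
  (F.card : ℂ)⁻¹ * ∑ k ∈ F, f k

theorem norm_average_le {M : Type*} {F : Finset M} (hF : F.Nonempty) {f : M → ℂ} {C : ℝ}
    (hf : ∀ k, ‖f k‖ ≤ C) : ‖average F f‖ ≤ C := by
  have hc : (0 : ℝ) < F.card := by exact_mod_cast hF.card_pos
  rw [average, norm_mul, norm_inv, Complex.norm_natCast, inv_mul_le_iff₀ hc]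
  refine (norm_sum_le _ _).trans ((Finset.sum_le_sum fun k _ => hf k).trans ?_)
  simp

open Classical in
theorem norm_average_translate_sub_le {F : Finset M} (hF : F.Nonempty) {f : M → ℂ} {C ε : ℝ}
    (hf : ∀ k, ‖f k‖ ≤ C) (a : M)
    (hFa : (1 - ε) * F.card ≤ ((F.image (· + a) ∩ F.image (· + 0)).card : ℝ)) :
    ‖average F (fun k => f (k + a)) - average F f‖ ≤ 2 * ε * C := by
  have hc : (0 : ℝ) < F.card := by exact_mod_cast hF.card_pos
  have hC : 0 ≤ C := (norm_nonneg _).trans (hf 0)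
  have hsum : ∑ k ∈ F, f (k + a) = ∑ k ∈ F.image (· + a), f k :=
    (Finset.sum_image fun x _ y _ h => add_left_injective a h).symm
  rw [average, average, ← mul_sub, hsum, ← Finset.sum_sdiff_sub_sum_sdiff, norm_mul, norm_inv,
    Complex.norm_natCast, inv_mul_le_iff₀ hc]
  have hb : ∀ s : Finset M, ‖∑ k ∈ s, f k‖ ≤ s.card * C := fun s =>
    (norm_sum_le _ _).trans ((Finset.sum_le_sum fun k _ => hf k).trans (by simp))
  have hcard : (F.image (· + a)).card = F.card :=
    Finset.card_image_of_injective _ (add_left_injective a)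
  have h0 : F.image (· + (0 : M)) = F := by simp
  rw [h0] at hFa
  have h1 : ((F.image (· + a) \ F).card : ℝ) ≤ ε * F.card := by
    have := Finset.card_sdiff_add_card_inter (F.image (· + a)) F
    have : ((F.image (· + a) \ F).card : ℝ) + (F.image (· + a) ∩ F).card = F.card := by
      rw [← hcard]; exact_mod_cast this
    linarith
  have h2 : ((F \ F.image (· + a)).card : ℝ) ≤ ε * F.card := by
    have := Finset.card_sdiff_add_card_inter F (F.image (· + a))
    have : ((F \ F.image (· + a)).card : ℝ) + (F.image (· + a) ∩ F).card = F.card := by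
      rw [Finset.inter_comm]; exact_mod_cast this
    linarith
  calc _ ≤ ((F.image (· + a) \ F).card : ℝ) * C + (F \ F.image (· + a)).card * C :=
        (norm_sub_le _ _).trans (add_le_add (hb _) (hb _))
    _ ≤ ε * F.card * C + ε * F.card * C := by gcongr
    _ = F.card * (2 * ε * C) := by ring

open Filter Topology in
/-- A cancellative commutative monoid has an invariant mean, namely an ultrafilter limit of
averages over Følner sets. -/
theorem nonempty_invariantMean (M : Type*) [AddCancelCommMonoid M] :
    Nonempty (InvariantMean M) := by
  classical
  have hpos : ∀ n : ℕ, (0 : ℝ) < 1 / ((n : ℝ) + 1) := fun n => by positivity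
  choose F hF hFA using fun i : Finset M × ℕ => exists_folner i.1 (hpos i.2)
  let U : Ultrafilter (Finset M × ℕ) := Ultrafilter.of atTop
  have hU : (U : Filter (Finset M × ℕ)) ≤ atTop := Ultrafilter.of_le _
  have hlim : ∀ (f : M → ℂ) (C : ℝ), (∀ k, ‖f k‖ ≤ C) →
      Tendsto (fun i => average (F i) f) U (𝓝 (limUnder U fun i => average (F i) f)) := by
    intro f C hf
    apply tendsto_nhds_limUnder
    have hK : IsCompact (Metric.closedBall (0 : ℂ) C) := isCompact_closedBall 0 C
    obtain ⟨z, -, hz⟩ := hK.ultrafilter_le_nhds (U.map fun i => average (F i) f) (by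
      refine le_principal_iff.2 (Ultrafilter.mem_coe.2 (Ultrafilter.mem_map.2 ?_))
      refine Filter.univ_mem' fun i => ?_
      simpa using norm_average_le (hF i) hf)
    exact ⟨z, hz⟩
  refine ⟨⟨fun f => limUnder U fun i => average (F i) f, ?_, ?_, ?_, ?_, ?_, ?_⟩⟩
  · intro f g C D hf hg
    refine Tendsto.limUnder_eq (((hlim f C hf).add (hlim g D hg)).congr fun i => ?_)
    simp [average, Finset.sum_add_distrib, mul_add]
  · intro c f C hf
    refine Tendsto.limUnder_eq (((hlim f C hf).const_mul c).congr fun i => ?_)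
    simp only [average, ← Finset.mul_sum]
    ring
  · intro f C hf
    exact le_of_tendsto (hlim f C hf).norm
      (Filter.Eventually.of_forall fun i => norm_average_le (hF i) hf)
  · intro c
    refine Tendsto.limUnder_eq (tendsto_const_nhds.congr fun i => ?_)
    have : ((F i).card : ℂ) ≠ 0 := by exact_mod_cast (hF i).card_pos.ne'
    simp only [average, Finset.sum_const, nsmul_eq_mul]
    field_simp
  · intro f C hf h0
    refine ge_of_tendsto ((Complex.continuous_re.tendsto _).comp (hlim f C hf))
      (Filter.Eventually.of_forall fun i => ?_)
    have : (average (F i) f).re = ((F i).card : ℝ)⁻¹ * ∑ k ∈ F i, (f k).re := by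
      rw [average, ← Complex.ofReal_natCast, ← Complex.ofReal_inv, Complex.re_ofReal_mul,
        Complex.re_sum]
    simp only [Function.comp, this]
    exact mul_nonneg (by positivity) (Finset.sum_nonneg fun k _ => h0 k)
  · intro f C a hf
    have hd := (hlim (fun k => f (k + a)) C fun k => hf _).sub (hlim f C hf)
    have hbound : Tendsto (fun i : Finset M × ℕ => 2 * (1 / ((i.2 : ℝ) + 1)) * C) U (𝓝 0) := by
      have : Tendsto (fun n : ℕ => 2 * (1 / ((n : ℝ) + 1)) * C) atTop (𝓝 0) := by
        simpa using (tendsto_one_div_add_atTop_nhds_zero_nat (𝕜 := ℝ)).const_mul 2 |>.mul_const C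
      refine this.comp (Tendsto.mono_left ?_ hU)
      rw [← prod_atTop_atTop_eq]
      exact tendsto_snd
    have hz : Tendsto (fun i => average (F i) (fun k => f (k + a)) - average (F i) f) U
        (𝓝 0) := by
      refine squeeze_zero_norm' ?_ hbound
      have hev : ∀ᶠ i : Finset M × ℕ in atTop, a ∈ i.1 ∧ 0 ∈ i.1 := by
        filter_upwards [eventually_ge_atTop (({a, 0} : Finset M), 0)] with i hi
        have := hi.1
        exact ⟨this (by simp), this (by simp)⟩
      filter_upwards [hU hev] with i hi
      exact norm_average_translate_sub_le (hF i) hf a (hFA i a hi.1 0 hi.2)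
    exact sub_eq_zero.1 (tendsto_nhds_unique hd hz)

end Folner

section Average

variable {M : Type*} [AddCancelCommMonoid M]
variable {X : Type*} [NormedAddCommGroup X] [InnerProductSpace ℂ X] [CompleteSpace X]

open ContinuousLinearMap

/-- Averaging of bounded operators over a commuting family of isometries `K`. The last clause
says that every linear relation `A (K m)† T (K m) = (K m)† T' (K m) B`, valid for all `m`,
survives averaging. -/
theorem exists_operator_average (K : M → X →L[ℂ] X) (hadd : ∀ m n, K (m + n) = K m * K n)
    (hiso : ∀ m x, ‖K m x‖ = ‖x‖) :
    ∃ E : (X →L[ℂ] X) → (X →L[ℂ] X),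
      (∀ T T', E (T + T') = E T + E T') ∧ E 1 = 1 ∧
      (∀ T, (∀ x, 0 ≤ (inner ℂ (T x) x).re) → ∀ x, 0 ≤ (inner ℂ (E T x) x).re) ∧
      (∀ T n, adjoint (K n) * E T * K n = E T) ∧
      (∀ A B T T', (∀ m, A * (adjoint (K m) * T * K m) = adjoint (K m) * T' * K m * B) →
        A * E T = E T' * B) := by
  obtain ⟨μ⟩ := nonempty_invariantMean M
  have hb : ∀ (T : X →L[ℂ] X) (x y : X) (k : M),
      ‖inner ℂ (T (K k x)) (K k y)‖ ≤ ‖T‖ * ‖x‖ * ‖y‖ := by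
    intro T x y k
    refine (norm_inner_le_norm _ _).trans ?_
    rw [hiso]
    gcongr
    simpa [hiso] using T.le_opNorm (K k x)
  have hE : ∀ T : X →L[ℂ] X, ∃ E : X →L[ℂ] X, ∀ x y,
      inner ℂ (E x) y = μ.toFun fun k => inner ℂ (T (K k x)) (K k y) := by
    intro T
    let B : X →L⋆[ℂ] X →L[ℂ] ℂ := LinearMap.mkContinuous₂
      (LinearMap.mk₂'ₛₗ (starRingEnd ℂ) (RingHom.id ℂ)
        (fun x y => μ.toFun fun k => inner ℂ (T (K k x)) (K k y))
        (fun x x' y => by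
          simp only [map_add, inner_add_left]
          exact μ.map_add _ _ _ _ (hb T x y) (hb T x' y))
        (fun c x y => by
          simp only [map_smul, inner_smul_left]
          exact μ.map_mul _ _ _ (hb T x y))
        (fun x y y' => by
          simp only [map_add, inner_add_right]
          exact μ.map_add _ _ _ _ (hb T x y) (hb T x y'))
        (fun c x y => by
          simp only [map_smul, inner_smul_right]
          exact μ.map_mul _ _ _ (hb T x y))) ‖T‖
      (fun x y => μ.norm_le _ _ (hb T x y))
    exact ⟨InnerProductSpace.continuousLinearMapOfBilin B, fun x y =>
      InnerProductSpace.continuousLinearMapOfBilin_apply B x y⟩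
  choose E hE using hE
  have hext : ∀ A B : X →L[ℂ] X, (∀ x y, inner ℂ (A x) y = inner ℂ (B x) y) → A = B :=
    fun A B h => ContinuousLinearMap.ext fun x => ext_inner_right ℂ fun y => h x y
  refine ⟨E, ?_, ?_, ?_, ?_, ?_⟩
  · intro T T'
    refine hext _ _ fun x y => ?_
    rw [hE, add_apply, inner_add_left, hE, hE, ← μ.map_add _ _ _ _ (hb T x y) (hb T' x y)]
    congr 1
    funext k
    exact inner_add_left _ _ _
  · refine hext _ _ fun x y => ?_
    have : ∀ k, inner ℂ (K k x) (K k y) = (inner ℂ x y : ℂ) := fun k =>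
      LinearIsometry.inner_map_map ⟨(K k).toLinearMap, hiso k⟩ x y
    rw [hE]
    simpa [this] using μ.map_const (inner ℂ x y)
  · intro T hT x
    rw [hE]
    exact μ.re_nonneg _ _ (hb T x x) fun k => hT _
  · intro T n
    refine hext _ _ fun x y => ?_
    have h := μ.map_translate _ _ n (hb T x y)
    rw [mul_apply_eq_comp, mul_apply_eq_comp, adjoint_inner_left, hE, hE, ← h]
    simp [hadd]
  · intro A B T T' h
    refine hext _ _ fun x y => ?_
    rw [mul_apply_eq_comp, mul_apply_eq_comp, ← adjoint_inner_right, hE, hE]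
    congr 1
    funext k
    have := congrArg (fun Z : X →L[ℂ] X => inner ℂ (Z x) y) (h k)
    simpa only [mul_apply_eq_comp, ← adjoint_inner_right A, adjoint_inner_left (K k)] using this

end Average

/-! ### Diagonal operators in the reduced C*-algebra -/

section StarRing

variable {A : Type*} [Ring A] [StarRing A]

theorem transport_mem_unitary {g v : A} (hg : star g * g = 1) (hv : v ∈ unitary A) :
    g * v * star g + (1 - g * star g) ∈ unitary A := by
  have e : ∀ z z' : A, (g * z * star g + (1 - g * star g)) *
      (g * z' * star g + (1 - g * star g)) = g * (z * z') * star g + (1 - g * star g) := by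
    intro z z'
    have k1 : g * z * star g * (g * z' * star g) = g * (z * z') * star g := by
      calc _ = g * z * (star g * g) * z' * star g := by simp only [mul_assoc]
        _ = _ := by rw [hg]; simp only [mul_assoc, one_mul]
    have k2 : g * z * star g * (g * star g) = g * z * star g := by
      calc _ = g * z * (star g * g) * star g := by simp only [mul_assoc]
        _ = _ := by rw [hg, mul_one]
    have k3 : g * star g * (g * z' * star g) = g * z' * star g := by
      calc _ = g * (star g * g) * z' * star g := by simp only [mul_assoc]
        _ = _ := by rw [hg, mul_one]
    have k4 : g * star g * (g * star g) = g * star g := by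
      calc _ = g * (star g * g) * star g := by simp only [mul_assoc]
        _ = _ := by rw [hg, mul_one]
    simp only [add_mul, mul_add, sub_mul, mul_sub, k1, k2, k3, k4, one_mul, mul_one]
    abel
  have hs : star (g * v * star g + (1 - g * star g)) =
      g * star v * star g + (1 - g * star g) := by
    simp [mul_assoc]
  rw [Unitary.mem_iff, hs, e, e, Unitary.star_mul_self_of_mem hv,
    Unitary.mul_star_self_of_mem hv]
  simp

theorem reflection_mem_unitary {g : A} (hg : star g * g = 1) :
    1 - (g * star g + g * star g) ∈ unitary A := by
  have k4 : g * star g * (g * star g) = g * star g := by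
    calc _ = g * (star g * g) * star g := by simp only [mul_assoc]
      _ = _ := by rw [hg, mul_one]
  have hs : star (1 - (g * star g + g * star g)) = 1 - (g * star g + g * star g) := by simp
  have hsq : (1 - (g * star g + g * star g)) * (1 - (g * star g + g * star g)) = 1 := by
    simp only [mul_add, sub_mul, mul_sub, add_mul, k4, one_mul, mul_one]
    abel
  rw [Unitary.mem_iff, hs, hsq]
  simp

end StarRing

section Reduced

open ContinuousLinearMap

variable {G : Type u} [AddCommGroup G] {S : AddSubmonoid G}

open Classical in
theorem regularShift_single (a c : S) (z : ℂ) :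
    regularShift a (lp.single 2 c z) = lp.single 2 (a + c) z := by
  ext b
  by_cases h : ∃ d : S, a + d = b
  · obtain ⟨d, rfl⟩ := h
    rw [regularShift_apply_add, lp.single_apply, lp.single_apply]
    by_cases hd : d = c
    · subst hd; simp
    · rw [Pi.single_eq_of_ne hd, Pi.single_eq_of_ne]
      exact fun h => hd (add_left_cancel h)
  · rw [regularShift_apply_of_not _ _ _ h, lp.single_apply, Pi.single_eq_of_ne]
    exact fun hb => h ⟨c, hb.symm⟩

/-- The operator `V_a` on `ℓ²(S)` as a bounded operator. -/
noncomputable abbrev regularOp (a : S) : L2 S →L[ℂ] L2 S :=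
  (regularShift a).toContinuousLinearMap

theorem regularOp_apply (a : S) (f : L2 S) : regularOp a f = regularShift a f := rfl

theorem star_regularOp_apply (a : S) (f : L2 S) (c : S) :
    (star (regularOp a) f : L2 S) c = f (a + c) := by
  classical
  have h : inner ℂ (lp.single 2 c (1 : ℂ) : L2 S) (star (regularOp a) f) =
      inner ℂ (regularOp a (lp.single 2 c 1)) f := by
    rw [star_eq_adjoint, adjoint_inner_right]
  rw [regularOp_apply, regularShift_single, lp.inner_single_left, lp.inner_single_left] at h
  simpa using h

theorem star_regularOp_mul_self (a : S) : star (regularOp a) * regularOp a = 1 := by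
  ext f c
  rw [mul_apply_eq_comp, star_regularOp_apply, regularOp_apply, regularShift_apply_add]
  rfl

theorem regularOp_add (a b : S) : regularOp (a + b) = regularOp a * regularOp b := by
  ext f s
  rw [mul_apply_eq_comp, regularOp_apply, regularOp_apply, regularOp_apply]
  by_cases h : ∃ c, a + c = s
  · obtain ⟨c, rfl⟩ := h
    rw [regularShift_apply_add]
    by_cases h' : ∃ d, b + d = c
    · obtain ⟨d, rfl⟩ := h'
      rw [regularShift_apply_add, ← add_assoc, regularShift_apply_add]
    · rw [regularShift_apply_of_not _ _ _ h', regularShift_apply_of_not]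
      rintro ⟨d, hd⟩
      exact h' ⟨d, add_left_cancel (by rw [← hd, add_assoc])⟩
  · rw [regularShift_apply_of_not _ _ _ h, regularShift_apply_of_not]
    rintro ⟨d, hd⟩
    exact h ⟨b + d, by rw [← hd, add_assoc]⟩

/-- A bounded operator on `ℓ²(S)` is diagonal if it multiplies every function by a fixed one. -/
def IsDiagonal (d : L2 S →L[ℂ] L2 S) : Prop := ∃ c : S → ℂ, ∀ f s, d f s = c s * f s

theorem IsDiagonal.one : IsDiagonal (1 : L2 S →L[ℂ] L2 S) :=
  ⟨fun _ => 1, fun _ _ => (one_mul _).symm⟩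

theorem IsDiagonal.mul {d e : L2 S →L[ℂ] L2 S} (hd : IsDiagonal d) (he : IsDiagonal e) :
    IsDiagonal (d * e) := by
  obtain ⟨c, hc⟩ := hd
  obtain ⟨c', hc'⟩ := he
  exact ⟨fun s => c s * c' s, fun f s => by rw [mul_apply_eq_comp, hc, hc', mul_assoc]⟩

theorem IsDiagonal.add {d e : L2 S →L[ℂ] L2 S} (hd : IsDiagonal d) (he : IsDiagonal e) :
    IsDiagonal (d + e) := by
  obtain ⟨c, hc⟩ := hd
  obtain ⟨c', hc'⟩ := he
  refine ⟨fun s => c s + c' s, fun f s => ?_⟩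
  rw [add_mul, ← hc, ← hc']
  rfl

theorem IsDiagonal.sub {d e : L2 S →L[ℂ] L2 S} (hd : IsDiagonal d) (he : IsDiagonal e) :
    IsDiagonal (d - e) := by
  obtain ⟨c, hc⟩ := hd
  obtain ⟨c', hc'⟩ := he
  refine ⟨fun s => c s - c' s, fun f s => ?_⟩
  rw [sub_mul, ← hc, ← hc']
  rfl

theorem IsDiagonal.commute {d e : L2 S →L[ℂ] L2 S} (hd : IsDiagonal d) (he : IsDiagonal e) :
    d * e = e * d := by
  obtain ⟨c, hc⟩ := hd
  obtain ⟨c', hc'⟩ := he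
  ext f s
  rw [mul_apply_eq_comp, mul_apply_eq_comp, hc, hc', hc', hc]
  ring

theorem IsDiagonal.conj {d : L2 S →L[ℂ] L2 S} (hd : IsDiagonal d) (a : S) :
    IsDiagonal (regularOp a * d * star (regularOp a)) := by
  classical
  obtain ⟨c, hc⟩ := hd
  refine ⟨Function.extend (fun t : S => a + t) c 0, fun f s => ?_⟩
  rw [mul_apply_eq_comp, mul_apply_eq_comp, regularOp_apply a (d _)]
  by_cases h : ∃ t, a + t = s
  · obtain ⟨t, rfl⟩ := h
    rw [regularShift_apply_add, hc, star_regularOp_apply, (add_left_inj' a).extend_apply]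
  · rw [regularShift_apply_of_not _ _ _ h, Function.extend_apply' _ _ _ h]
    simp

theorem IsDiagonal.rangeProj (a : S) : IsDiagonal (regularOp a * star (regularOp a)) := by
  simpa using IsDiagonal.one.conj a

/-- The generator `V_a` of the reduced C*-algebra. -/
noncomputable def reducedGen (a : S) : ReducedCStar S :=
  ⟨regularOp a, StarSubalgebra.le_topologicalClosure _
    (StarAlgebra.subset_adjoin ℂ _ ⟨a, rfl⟩)⟩

theorem star_reducedGen_mul_self (a : S) : star (reducedGen a) * reducedGen a = 1 :=
  Subtype.ext (star_regularOp_mul_self a)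

theorem reducedGen_add (a b : S) : reducedGen (a + b) = reducedGen a * reducedGen b :=
  Subtype.ext (regularOp_add a b)

variable (S) in
/-- The diagonal unitaries of the reduced C*-algebra. -/
def diagUnitary : Submonoid (unitary (ReducedCStar S)) where
  carrier := {u | IsDiagonal (u : ReducedCStar S).1}
  one_mem' := IsDiagonal.one
  mul_mem' hu hv := IsDiagonal.mul hu hv

noncomputable instance : CancelCommMonoid (diagUnitary S) :=
  { (inferInstance : Monoid (diagUnitary S)) with
    mul_comm := fun u v => Subtype.ext (Subtype.ext (Subtype.ext (u.2.commute v.2)))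
    mul_left_cancel := fun _ _ _ h => mul_left_cancel h }

/-- The element of the reduced C*-algebra underlying a diagonal unitary. -/
def diagVal (u : diagUnitary S) : ReducedCStar S := u.1.1

theorem diagVal_mul (u v : diagUnitary S) : diagVal (u * v) = diagVal u * diagVal v := rfl

theorem star_diagVal_mul_self (u : diagUnitary S) : star (diagVal u) * diagVal u = 1 :=
  Unitary.coe_star_mul_self u.1

theorem diagVal_mul_star_self (u : diagUnitary S) : diagVal u * star (diagVal u) = 1 :=
  Unitary.coe_mul_star_self u.1

/-- A diagonal unitary `u`, transported along `V_a` and extended by the identity to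
`V_a u V_a^* + (1 - V_a V_a^*)`, is again a diagonal unitary. -/
theorem exists_transport (a : S) (u : diagUnitary S) : ∃ v : diagUnitary S, diagVal v =
    reducedGen a * diagVal u * star (reducedGen a) +
      (1 - reducedGen a * star (reducedGen a)) :=
  ⟨⟨⟨_, transport_mem_unitary (star_reducedGen_mul_self a) u.1.2⟩,
    (u.2.conj a).add (IsDiagonal.one.sub (IsDiagonal.rangeProj a))⟩, rfl⟩

/-- The symmetry `1 - 2 V_a V_a^*` is a diagonal unitary. -/
theorem exists_reflection (a : S) : ∃ v : diagUnitary S, diagVal v =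
    1 - (reducedGen a * star (reducedGen a) + reducedGen a * star (reducedGen a)) :=
  ⟨⟨⟨_, reflection_mem_unitary (star_reducedGen_mul_self a)⟩,
    IsDiagonal.one.sub ((IsDiagonal.rangeProj a).add (IsDiagonal.rangeProj a))⟩, rfl⟩

end Reduced

/-! ### A conditional expectation onto the commutant -/

section Expectation

open ContinuousLinearMap

variable {X : Type*} [NormedAddCommGroup X] [InnerProductSpace ℂ X] [CompleteSpace X]

theorem norm_apply_of_star_mul_self {V : X →L[ℂ] X} (h : star V * V = 1) (x : X) :
    ‖V x‖ = ‖x‖ := by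
  have h1 : inner ℂ (V x) (V x) = (inner ℂ x x : ℂ) := by
    rw [← adjoint_inner_right, ← star_eq_adjoint, ← mul_apply_eq_comp, h]
    rfl
  rw [inner_self_eq_norm_sq_to_K, inner_self_eq_norm_sq_to_K] at h1
  exact (sq_eq_sq₀ (norm_nonneg _) (norm_nonneg _)).1 (by exact_mod_cast h1)

/-- Let the isometries `R a` represent `M`, and let the unitaries `D u` represent a commutative
group-like monoid `U` which is stable under transport along the `R a` and contains the symmetries
`1 - 2 R a (R a)†`. Averaging over `U`, then over `M`, gives a positive unital map onto the
commutant of the `R a` which is a bimodule map over the commutant of all `R a` and `D u`. -/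
theorem exists_expectation_of_transport {M U : Type*} [AddCancelCommMonoid M]
    [AddCancelCommMonoid U] (R : M → X →L[ℂ] X) (D : U → X →L[ℂ] X)
    (hRadd : ∀ a b, R (a + b) = R a * R b) (hDadd : ∀ u v, D (u + v) = D u * D v)
    (hRR : ∀ a, star (R a) * R a = 1) (hDD : ∀ u, star (D u) * D u = 1)
    (hDD' : ∀ u, D u * star (D u) = 1)
    (htrans : ∀ a u, ∃ v, D v = R a * D u * star (R a) + (1 - R a * star (R a)))
    (hrefl : ∀ a, ∃ v, D v = 1 - (R a * star (R a) + R a * star (R a))) :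
    ∃ E : (X →L[ℂ] X) → (X →L[ℂ] X),
      (∀ T T', E (T + T') = E T + E T') ∧ E 1 = 1 ∧
      (∀ T, (∀ x, 0 ≤ (inner ℂ (T x) x).re) → ∀ x, 0 ≤ (inner ℂ (E T x) x).re) ∧
      (∀ T a, E T * R a = R a * E T ∧ E T * star (R a) = star (R a) * E T) ∧
      (∀ L, (∀ a, L * R a = R a * L ∧ L * star (R a) = star (R a) * L) →
        (∀ u, L * D u = D u * L ∧ L * star (D u) = star (D u) * L) →
        ∀ T, E (L * T) = L * E T ∧ E (T * L) = E T * L) := by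
  obtain ⟨E₁, add₁, one₁, pos₁, inv₁, rel₁⟩ := exists_operator_average D hDadd
    (fun u => norm_apply_of_star_mul_self (hDD u))
  obtain ⟨E₂, add₂, one₂, pos₂, inv₂, rel₂⟩ := exists_operator_average R hRadd
    (fun a => norm_apply_of_star_mul_self (hRR a))
  simp only [← star_eq_adjoint] at inv₁ rel₁ inv₂ rel₂
  have comm₁ : ∀ T u, D u * E₁ T = E₁ T * D u := fun T u => by
    conv_lhs => rw [← inv₁ T u]
    rw [← mul_assoc, ← mul_assoc, hDD', one_mul]
  -- compressing by `R a` preserves the commutant of the diagonal unitaries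
  have transport : ∀ (T : X →L[ℂ] X), (∀ u, D u * T = T * D u) →
      ∀ a u, D u * (star (R a) * T * R a) = star (R a) * T * R a * D u := by
    intro T hT a u
    obtain ⟨v, hval⟩ := htrans a u
    have h1 : star (R a) * D v = D u * star (R a) := by
      rw [hval, mul_add, mul_sub, ← mul_assoc, ← mul_assoc, ← mul_assoc, hRR]
      simp
    have h2 : D v * R a = R a * D u := by
      rw [hval, add_mul, sub_mul, mul_assoc, mul_assoc (R a) (star (R a)), hRR]
      simp
    calc D u * (star (R a) * T * R a) = D u * star (R a) * T * R a := by
          simp only [mul_assoc]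
      _ = star (R a) * (T * D v) * R a := by
          rw [← h1, mul_assoc (star (R a)), hT]
      _ = star (R a) * T * R a * D u := by
          rw [mul_assoc, mul_assoc, h2]
          simp only [mul_assoc]
  have comm₂ : ∀ T u, D u * E₂ (E₁ T) = E₂ (E₁ T) * D u := fun T u =>
    rel₂ _ _ _ _ fun a => transport _ (comm₁ T) a u
  -- the range projections of the `R a` are among the diagonal operators
  have range_comm : ∀ T a, R a * star (R a) * E₂ (E₁ T) = E₂ (E₁ T) * (R a * star (R a)) := by
    intro T a
    obtain ⟨v, hval⟩ := hrefl a
    rw [← two_smul ℂ] at hval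
    have h := comm₂ T v
    rw [hval, sub_mul, mul_sub, one_mul, mul_one, sub_right_inj, smul_mul_assoc,
      mul_smul_comm] at h
    exact smul_right_injective _ (two_ne_zero' ℂ) h
  have main : ∀ L, (∀ a, L * R a = R a * L ∧ L * star (R a) = star (R a) * L) →
      (∀ u, L * D u = D u * L ∧ L * star (D u) = star (D u) * L) → ∀ T,
      E₂ (E₁ (L * T)) = L * E₂ (E₁ T) ∧ E₂ (E₁ (T * L)) = E₂ (E₁ T) * L := by
    intro L hLR hLD T
    constructor
    · have h1 : L * E₁ T = E₁ (L * T) := by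
        simpa using rel₁ L 1 T (L * T) fun u => by
          rw [← mul_assoc, ← mul_assoc, (hLD u).2, mul_one]
          simp only [mul_assoc]
      have h2 : L * E₂ (E₁ T) = E₂ (L * E₁ T) := by
        simpa using rel₂ L 1 (E₁ T) (L * E₁ T) fun a => by
          rw [← mul_assoc, ← mul_assoc, (hLR a).2, mul_one]
          simp only [mul_assoc]
      rw [h2, h1]
    · have h1 : E₁ (T * L) = E₁ T * L := by
        simpa using rel₁ 1 L (T * L) T fun u => by
          rw [one_mul, mul_assoc, mul_assoc, (hLD u).1]
          simp only [mul_assoc]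
      rw [h1]
      simpa using rel₂ 1 L (E₁ T * L) (E₁ T) fun a => by
        rw [one_mul, mul_assoc, mul_assoc, (hLR a).1]
        simp only [mul_assoc]
  refine ⟨fun T => E₂ (E₁ T), fun T T' => by simp only [add₁, add₂], by simp only [one₁, one₂],
    fun T hT => pos₂ _ (pos₁ _ hT), fun T a => ⟨?_, ?_⟩, main⟩
  · change E₂ (E₁ T) * R a = R a * E₂ (E₁ T)
    conv_rhs => rw [← inv₂ _ a]
    rw [← mul_assoc, ← mul_assoc, range_comm, mul_assoc, mul_assoc, hRR, mul_one]
  · change E₂ (E₁ T) * star (R a) = star (R a) * E₂ (E₁ T)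
    conv_lhs => rw [← inv₂ _ a]
    rw [mul_assoc, mul_assoc, ← range_comm, ← mul_assoc, ← mul_assoc, hRR, one_mul]

/-- The map of `exists_expectation_of_transport`, for isometries and unitaries which are images of
elements of a star algebra `A`. -/
theorem exists_expectation_of_starAlgHom {A M U : Type*} [Ring A] [StarRing A] [Algebra ℂ A]
    [AddCancelCommMonoid M] [AddCancelCommMonoid U] (g : M → A) (d : U → A)
    (hgadd : ∀ a b, g (a + b) = g a * g b) (hdadd : ∀ u v, d (u + v) = d u * d v)
    (hgg : ∀ a, star (g a) * g a = 1) (hdd : ∀ u, star (d u) * d u = 1)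
    (hdd' : ∀ u, d u * star (d u) = 1)
    (htrans : ∀ a u, ∃ v, d v = g a * d u * star (g a) + (1 - g a * star (g a)))
    (hrefl : ∀ a, ∃ v, d v = 1 - (g a * star (g a) + g a * star (g a)))
    (w : A →⋆ₐ[ℂ] (X →L[ℂ] X)) :
    ∃ E : (X →L[ℂ] X) → (X →L[ℂ] X),
      (∀ T T', E (T + T') = E T + E T') ∧ E 1 = 1 ∧
      (∀ T, (∀ x, 0 ≤ (inner ℂ (T x) x).re) → ∀ x, 0 ≤ (inner ℂ (E T x) x).re) ∧
      (∀ T a, E T * w (g a) = w (g a) * E T ∧ E T * star (w (g a)) = star (w (g a)) * E T) ∧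
      (∀ L, (∀ z, L * w z = w z * L) → ∀ T, E (L * T) = L * E T ∧ E (T * L) = E T * L) := by
  have hstar : ∀ z, star (w z) = w (star z) := fun z => (map_star w z).symm
  obtain ⟨E, h1, h2, h3, h4, h5⟩ := exists_expectation_of_transport
    (fun a => w (g a)) (fun u => w (d u))
    (fun a b => by simp only [hgadd, map_mul]) (fun u v => by simp only [hdadd, map_mul])
    (fun a => by rw [hstar, ← map_mul, hgg, map_one])
    (fun u => by rw [hstar, ← map_mul, hdd, map_one])
    (fun u => by rw [hstar, ← map_mul, hdd', map_one])
    (fun a u => by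
      obtain ⟨v, hv⟩ := htrans a u
      exact ⟨v, by simp only [hv, map_add, map_sub, map_mul, map_star, map_one]⟩)
    (fun a => by
      obtain ⟨v, hv⟩ := hrefl a
      exact ⟨v, by simp only [hv, map_add, map_sub, map_mul, map_star, map_one]⟩)
  exact ⟨E, h1, h2, h3, h4, fun L hL => h5 L (fun a => ⟨hL _, by rw [hstar, hL]⟩)
    fun u => ⟨hL _, by rw [hstar, hL]⟩⟩

instance {G : Type u} [AddCommGroup G] (S : AddSubmonoid G) : AddCancelCommMonoid S :=
  { (inferInstance : AddCommMonoid S) with add_left_cancel := fun _ _ _ h => add_left_cancel h }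

/-- For every representation `w` of the reduced C*-algebra there is a positive unital map onto
the commutant of the generators which is a bimodule map over the commutant of the image. -/
theorem exists_expectation {G : Type u} [AddCommGroup G] {S : AddSubmonoid G}
    (w : ReducedCStar S →⋆ₐ[ℂ] (X →L[ℂ] X)) :
    ∃ E : (X →L[ℂ] X) → (X →L[ℂ] X),
      (∀ T T', E (T + T') = E T + E T') ∧ E 1 = 1 ∧
      (∀ T, (∀ x, 0 ≤ (inner ℂ (T x) x).re) → ∀ x, 0 ≤ (inner ℂ (E T x) x).re) ∧
      (∀ T a, E T * w (reducedGen a) = w (reducedGen a) * E T ∧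
        E T * star (w (reducedGen a)) = star (w (reducedGen a)) * E T) ∧
      (∀ L, (∀ z, L * w z = w z * L) → ∀ T, E (L * T) = L * E T ∧ E (T * L) = E T * L) :=
  exists_expectation_of_starAlgHom (U := Additive (diagUnitary S)) reducedGen
    (fun u => diagVal u.toMul) reducedGen_add (fun u v => diagVal_mul u.toMul v.toMul)
    star_reducedGen_mul_self (fun u => star_diagVal_mul_self u.toMul)
    (fun u => diagVal_mul_star_self u.toMul)
    (fun a u => (exists_transport a u.toMul).imp fun _ h => h) exists_reflection w

end Expectation

/-! ### Operators on `ℓ²` of a set -/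

section L2

open ContinuousLinearMap

variable {Ω : Type*}

/-- The Hilbert space `ℓ²(Ω)`. -/
abbrev EllTwo (Ω : Type*) : Type _ := lp (fun _ : Ω => ℂ) 2

open Classical in
/-- The standard basis vector of `ℓ²(Ω)` at `ω`. -/
noncomputable def basisVec (ω : Ω) : EllTwo Ω := lp.single 2 ω 1

open Classical in
theorem basisVec_apply (ω ω' : Ω) : basisVec ω ω' = if ω' = ω then 1 else 0 := by
  rw [basisVec, lp.single_apply, Pi.single_apply]

open Classical in
theorem inner_basisVec (ω ω' : Ω) :
    inner ℂ (basisVec ω) (basisVec ω') = if ω = ω' then (1 : ℂ) else 0 := by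
  rw [basisVec, lp.inner_single_left, basisVec_apply]
  simp

/-- The unitary of `ℓ²(Ω)` induced by a permutation of `Ω`. -/
noncomputable def permOp (σ : Equiv.Perm Ω) : EllTwo Ω →ₗᵢ[ℂ] EllTwo Ω where
  toFun f := ⟨fun ω => f (σ.symm ω), memℓp_gen
    (((lp.memℓp f).summable (by norm_num)).comp_injective σ.symm.injective)⟩
  map_add' f g := by ext; rfl
  map_smul' c f := by ext; rfl
  norm_map' f := by
    have hp : (0 : ℝ) < (2 : ℝ≥0∞).toReal := by norm_num
    refine (Real.rpow_left_inj (norm_nonneg _) (norm_nonneg _) hp.ne').1 ?_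
    rw [lp.norm_rpow_eq_tsum hp, lp.norm_rpow_eq_tsum hp]
    exact σ.symm.tsum_eq fun ω => ‖f ω‖ ^ (2 : ℝ≥0∞).toReal

theorem permOp_apply (σ : Equiv.Perm Ω) (f : EllTwo Ω) (ω : Ω) :
    permOp σ f ω = f (σ.symm ω) := rfl

theorem permOp_basisVec (σ : Equiv.Perm Ω) (ω : Ω) :
    permOp σ (basisVec ω) = basisVec (σ ω) := by
  classical
  ext ω'
  rw [permOp_apply, basisVec_apply, basisVec_apply]
  exact if_congr (Equiv.symm_apply_eq σ) rfl rfl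

open Classical in
/-- The operator on `ℓ²(Ω)` of multiplication by the indicator function of `B`. -/
noncomputable def indicatorOp (B : Set Ω) : EllTwo Ω →L[ℂ] EllTwo Ω :=
  have hle : ∀ (f : EllTwo Ω) ω, ‖if ω ∈ B then f ω else 0‖ ≤ ‖f ω‖ := fun f ω => by
    split_ifs <;> simp
  have hp : (0 : ℝ) < (2 : ℝ≥0∞).toReal := by norm_num
  LinearMap.mkContinuous
    { toFun := fun f => ⟨fun ω => if ω ∈ B then f ω else 0, memℓp_gen
        (Summable.of_nonneg_of_le (fun _ => by positivity)
          (fun ω => Real.rpow_le_rpow (norm_nonneg _) (hle f ω) hp.le)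
          ((lp.memℓp f).summable hp))⟩
      map_add' := fun f g => by
        ext ω
        change (if ω ∈ B then f ω + g ω else 0) =
          (if ω ∈ B then f ω else 0) + (if ω ∈ B then g ω else 0)
        split_ifs <;> simp
      map_smul' := fun c f => by
        ext ω
        change (if ω ∈ B then c * f ω else 0) = c * (if ω ∈ B then f ω else 0)
        split_ifs <;> simp } 1 (fun f => by
      rw [one_mul]
      refine lp.norm_le_of_forall_sum_le hp (norm_nonneg _) fun s => ?_
      refine le_trans (Finset.sum_le_sum fun ω _ => ?_) (lp.sum_rpow_le_norm_rpow hp f s)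
      exact Real.rpow_le_rpow (norm_nonneg _) (hle f ω) hp.le)

open Classical in
theorem indicatorOp_apply (B : Set Ω) (f : EllTwo Ω) (ω : Ω) :
    indicatorOp B f ω = if ω ∈ B then f ω else 0 := rfl

theorem indicatorOp_univ : indicatorOp (Set.univ : Set Ω) = 1 := by
  ext f ω
  rw [indicatorOp_apply, if_pos (Set.mem_univ _)]
  rfl

theorem indicatorOp_union {A B : Set Ω} (h : Disjoint A B) :
    indicatorOp (A ∪ B) = indicatorOp A + indicatorOp B := by
  classical
  ext f ω
  change indicatorOp (A ∪ B) f ω = indicatorOp A f ω + indicatorOp B f ω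
  rw [indicatorOp_apply, indicatorOp_apply, indicatorOp_apply]
  by_cases hA : ω ∈ A
  · have hB : ω ∉ B := Set.disjoint_left.1 h hA
    simp [hA, hB]
  · simp [hA]

theorem indicatorOp_inner_nonneg (B : Set Ω) (f : EllTwo Ω) :
    0 ≤ (inner ℂ (indicatorOp B f) f).re := by
  classical
  have h := lp.hasSum_inner (𝕜 := ℂ) (indicatorOp B f) f
  refine (Complex.hasSum_re h).nonneg fun ω => ?_
  rw [indicatorOp_apply]
  split_ifs
  · exact inner_self_nonneg (𝕜 := ℂ) (x := f ω)
  · simp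

theorem permOp_indicatorOp (σ : Equiv.Perm Ω) (B : Set Ω) (f : EllTwo Ω) :
    permOp σ (indicatorOp B f) = indicatorOp (σ.symm ⁻¹' B) (permOp σ f) := by
  ext ω
  rfl

theorem mul_star_comm_of_star_eq {A : Type*} [Mul A] [StarMul A] {l l' v : A} (hl : star l' = l)
    (h : l' * v = v * l') : l * star v = star v * l := by
  rw [← hl, ← star_mul, ← star_mul, h]

end L2

/-! ### An isometric representation whose commutant traces a group -/

section Model

open ContinuousLinearMap

variable {G : Type u} [AddCommGroup G] (S : AddSubmonoid G) (a : G)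
variable {Γ : Type} [Group Γ] (s t : Γ)

/-- The vector `δ_{(p,0,γ)} + δ_{(p+a,0,γs)} + δ_{(p,1,γ)} + δ_{(p+a,1,γt)}`. -/
noncomputable def modelVec (p : G) (γ : Γ) : EllTwo (G × Bool × Γ) :=
  basisVec (p, false, γ) + basisVec (p + a, false, γ * s) +
    (basisVec (p, true, γ) + basisVec (p + a, true, γ * t))

/-- The closed span of the vectors `modelVec p γ` with `p ∈ S`. -/
noncomputable def modelSpace : Submodule ℂ (EllTwo (G × Bool × Γ)) :=
  (Submodule.span ℂ (Set.range fun q : S × Γ => modelVec a s t q.1 q.2)).topologicalClosure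

theorem isClosed_modelSpace : IsClosed (modelSpace S a s t : Set (EllTwo (G × Bool × Γ))) :=
  Submodule.isClosed_topologicalClosure _

instance : CompleteSpace (modelSpace S a s t) :=
  (isClosed_modelSpace S a s t).completeSpace_coe

theorem modelVec_mem (p : S) (γ : Γ) : modelVec a s t p γ ∈ modelSpace S a s t :=
  Submodule.le_topologicalClosure _ (Submodule.subset_span ⟨(p, γ), rfl⟩)

/-- The vector `modelVec p γ` as an element of the model space. -/
noncomputable def modelPt (p : S) (γ : Γ) : modelSpace S a s t :=
  ⟨modelVec a s t p γ, modelVec_mem S a s t p γ⟩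

theorem map_mem_modelSpace (U : EllTwo (G × Bool × Γ) →ₗᵢ[ℂ] EllTwo (G × Bool × Γ))
    (hU : ∀ (p : S) γ, U (modelVec a s t p γ) ∈ modelSpace S a s t) :
    ∀ f ∈ modelSpace S a s t, U f ∈ modelSpace S a s t := by
  have : modelSpace S a s t ≤ (modelSpace S a s t).comap U.toLinearMap := by
    refine Submodule.topologicalClosure_minimal _ (Submodule.span_le.2 ?_)
      ((isClosed_modelSpace S a s t).preimage U.continuous)
    rintro _ ⟨q, rfl⟩
    exact hU q.1 q.2
  exact this

/-- An isometry of `ℓ²` preserving the model space, as an operator on it. -/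
noncomputable def modelRestrict (U : EllTwo (G × Bool × Γ) →ₗᵢ[ℂ] EllTwo (G × Bool × Γ))
    (hU : ∀ (p : S) γ, U (modelVec a s t p γ) ∈ modelSpace S a s t) :
    modelSpace S a s t →L[ℂ] modelSpace S a s t :=
  (U.toContinuousLinearMap.comp (modelSpace S a s t).subtypeL).codRestrict _
    fun f => map_mem_modelSpace S a s t U hU f f.2

/-- Translation by `p` in the first coordinate. -/
def translatePerm (Γ : Type) (p : G) : Equiv.Perm (G × Bool × Γ) :=
  (Equiv.addLeft p).prodCongr (Equiv.refl _)

/-- Left multiplication by `g` in the last coordinate. -/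
def leftPerm (G : Type u) (g : Γ) : Equiv.Perm (G × Bool × Γ) :=
  (Equiv.refl _).prodCongr ((Equiv.refl _).prodCongr (Equiv.mulLeft g))

theorem translate_modelVec (p q : G) (γ : Γ) :
    permOp (translatePerm Γ p) (modelVec a s t q γ) = modelVec a s t (p + q) γ := by
  simp [modelVec, permOp_basisVec, translatePerm, add_assoc]

theorem left_modelVec (g : Γ) (q : G) (γ : Γ) :
    permOp (leftPerm G g) (modelVec a s t q γ) = modelVec a s t q (g * γ) := by
  simp [modelVec, permOp_basisVec, leftPerm, mul_assoc]

/-- The isometry of the model space given by translation by `p ∈ S`. -/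
noncomputable def modelShift (p : S) : modelSpace S a s t →L[ℂ] modelSpace S a s t :=
  modelRestrict S a s t (permOp (translatePerm Γ (p : G))) fun q γ => by
    rw [translate_modelVec]
    exact modelVec_mem S a s t (p + q) γ

/-- The unitary of the model space given by left multiplication by `g ∈ Γ`. -/
noncomputable def modelLeft (g : Γ) : modelSpace S a s t →L[ℂ] modelSpace S a s t :=
  modelRestrict S a s t (permOp (leftPerm G g)) fun q γ => by
    rw [left_modelVec]
    exact modelVec_mem S a s t q (g * γ)

/-- The compression to the model space of multiplication by the indicator function of
`G × Bool × B`, for a subset `B` of `Γ`. -/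
noncomputable def modelCompress (B : Set Γ) : modelSpace S a s t →L[ℂ] modelSpace S a s t :=
  adjoint (modelSpace S a s t).subtypeL ∘L
    (indicatorOp {ω : G × Bool × Γ | ω.2.2 ∈ B} ∘L (modelSpace S a s t).subtypeL)

variable {S a s t}

theorem modelShift_pt (p q : S) (γ : Γ) :
    modelShift S a s t p (modelPt S a s t q γ) = modelPt S a s t (p + q) γ :=
  Subtype.ext (translate_modelVec a s t p q γ)

theorem modelLeft_pt (g : Γ) (q : S) (γ : Γ) :
    modelLeft S a s t g (modelPt S a s t q γ) = modelPt S a s t q (g * γ) :=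
  Subtype.ext (left_modelVec a s t g q γ)

theorem norm_modelShift (p : S) (x : modelSpace S a s t) : ‖modelShift S a s t p x‖ = ‖x‖ :=
  (permOp (translatePerm Γ (p : G))).norm_map x

theorem norm_modelLeft (g : Γ) (x : modelSpace S a s t) : ‖modelLeft S a s t g x‖ = ‖x‖ :=
  (permOp (leftPerm G g)).norm_map x

theorem modelShift_add (p q : S) :
    modelShift S a s t (p + q) = modelShift S a s t p * modelShift S a s t q := by
  ext x ⟨r, i, γ⟩
  change (x : EllTwo (G × Bool × Γ)) (-(p + q : G) + r, i, γ) =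
    (x : EllTwo (G × Bool × Γ)) (-(q : G) + (-(p : G) + r), i, γ)
  rw [show -(p + q : G) + r = -(q : G) + (-(p : G) + r) by abel]

theorem modelLeft_mul_inv (g : Γ) : modelLeft S a s t g * modelLeft S a s t g⁻¹ = 1 := by
  ext x ⟨r, i, γ⟩
  change (x : EllTwo (G × Bool × Γ)) (r, i, g⁻¹⁻¹ * (g⁻¹ * γ)) =
    (x : EllTwo (G × Bool × Γ)) (r, i, γ)
  simp

theorem star_modelLeft (g : Γ) : star (modelLeft S a s t g) = modelLeft S a s t g⁻¹ := by
  have h : star (modelLeft S a s t g) * modelLeft S a s t g = 1 :=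
    (norm_map_iff_adjoint_comp_self _).1 (norm_modelLeft g)
  calc _ = star (modelLeft S a s t g) * (modelLeft S a s t g * modelLeft S a s t g⁻¹) := by
        rw [modelLeft_mul_inv, mul_one]
    _ = _ := by rw [← mul_assoc, h, one_mul]

theorem modelLeft_mul_modelShift (g : Γ) (p : S) :
    modelLeft S a s t g * modelShift S a s t p = modelShift S a s t p * modelLeft S a s t g := by
  ext x ⟨r, i, γ⟩
  rfl

theorem modelLeft_mul_star_modelShift (g : Γ) (p : S) :
    modelLeft S a s t g * star (modelShift S a s t p) =
      star (modelShift S a s t p) * modelLeft S a s t g :=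
  mul_star_comm_of_star_eq (by rw [star_modelLeft, inv_inv])
    (modelLeft_mul_modelShift g⁻¹ p)

theorem inner_modelCompress_left (B : Set Γ) (x y : modelSpace S a s t) :
    inner ℂ (modelCompress S a s t B x) y =
      inner ℂ (indicatorOp {ω : G × Bool × Γ | ω.2.2 ∈ B} x) (y : EllTwo (G × Bool × Γ)) :=
  adjoint_inner_left (modelSpace S a s t).subtypeL y _

theorem modelCompress_univ : modelCompress S a s t Set.univ = 1 := by
  ext1 x
  refine ext_inner_right ℂ fun y => ?_
  rw [inner_modelCompress_left]
  simp only [Set.mem_univ, Set.ofPred_true, indicatorOp_univ]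
  rfl

theorem modelCompress_union {A B : Set Γ} (h : Disjoint A B) :
    modelCompress S a s t (A ∪ B) = modelCompress S a s t A + modelCompress S a s t B := by
  ext1 x
  refine ext_inner_right ℂ fun y => ?_
  have hd : Disjoint {ω : G × Bool × Γ | ω.2.2 ∈ A} {ω | ω.2.2 ∈ B} :=
    Disjoint.preimage (fun ω : G × Bool × Γ => ω.2.2) h
  have hu := indicatorOp_union hd
  rw [add_apply, inner_add_left, inner_modelCompress_left, inner_modelCompress_left,
    inner_modelCompress_left, ← inner_add_left, ← add_apply, ← hu]
  rfl

theorem modelCompress_nonneg (B : Set Γ) (x : modelSpace S a s t) :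
    0 ≤ (inner ℂ (modelCompress S a s t B x) x).re := by
  rw [inner_modelCompress_left]
  exact indicatorOp_inner_nonneg _ _

theorem modelLeft_mul_modelCompress (g : Γ) (B : Set Γ) :
    modelLeft S a s t g * modelCompress S a s t B =
      modelCompress S a s t ((g⁻¹ * ·) ⁻¹' B) * modelLeft S a s t g := by
  ext1 x
  refine ext_inner_right ℂ fun y => ?_
  rw [mul_apply_eq_comp, mul_apply_eq_comp, inner_modelCompress_left,
    ← adjoint_inner_right, ← star_eq_adjoint, star_modelLeft, inner_modelCompress_left,
    ← LinearIsometry.inner_map_map (permOp (leftPerm G g)), permOp_indicatorOp]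
  have hy : permOp (leftPerm G g) (modelLeft S a s t g⁻¹ y : EllTwo (G × Bool × Γ)) =
      (y : EllTwo (G × Bool × Γ)) :=
    congrArg (fun Z : modelSpace S a s t →L[ℂ] modelSpace S a s t =>
      (Z y : EllTwo (G × Bool × Γ))) (modelLeft_mul_inv g)
  rw [hy]
  rfl

theorem eq_zero_of_inner_modelPt {x : modelSpace S a s t}
    (h : ∀ p γ, inner ℂ (modelPt S a s t p γ) x = 0) : x = 0 := by
  have h1 : (x : EllTwo (G × Bool × Γ)) ∈ (modelSpace S a s t)ᗮ := by
    suffices hx : (x : EllTwo (G × Bool × Γ)) ∈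
        (Submodule.span ℂ (Set.range fun q : S × Γ => modelVec a s t q.1 q.2))ᗮ by
      rw [← Submodule.orthogonal_closure] at hx
      exact hx
    rw [Submodule.mem_orthogonal]
    intro u hu
    induction hu using Submodule.span_induction with
    | mem u hu =>
      obtain ⟨q, rfl⟩ := hu
      exact h q.1 q.2
    | zero => simp
    | add u v _ _ hu hv => rw [inner_add_left, hu, hv, add_zero]
    | smul c u _ hu => rw [inner_smul_left, hu, mul_zero]
  have h2 := Submodule.inner_right_of_mem_orthogonal x.2 h1
  exact Subtype.ext (inner_self_eq_zero.1 h2)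

end Model

/-! ### A trace property of the commutant of the model representation -/

section Trace

open ContinuousLinearMap

variable {G : Type u} [AddCommGroup G] {S : AddSubmonoid G} {a : G}
variable {Γ : Type} [Group Γ] {s t : Γ}

theorem inner_modelPt_zero_of_ne (ha : a ∉ S) (hna : -a ∉ S) {p : S} (hp : p ≠ 0) (γ γ' : Γ) :
    inner ℂ (modelPt S a s t p γ) (modelPt S a s t 0 γ') = 0 := by
  classical
  have h0 : (p : G) ≠ 0 := fun h => hp (Subtype.ext h)
  have h1 : (p : G) ≠ a := fun h => ha (h ▸ p.2)
  have h2 : (p : G) + a ≠ 0 := fun h => hna (by rw [← eq_neg_of_add_eq_zero_left h]; exact p.2)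
  simp [modelPt, modelVec, inner_add_left, inner_add_right, inner_basisVec, h0, h1, h2]

open Classical in
theorem inner_modelPt_zero_zero (ha : a ∉ S) (γ γ' : Γ) :
    inner ℂ (modelPt S a s t 0 γ) (modelPt S a s t 0 γ') = if γ = γ' then (4 : ℂ) else 0 := by
  have h0 : a ≠ 0 := fun h => ha (h ▸ S.zero_mem)
  simp only [modelPt, modelVec, Submodule.coe_inner, inner_add_left, inner_add_right,
    inner_basisVec, Prod.mk.injEq, ZeroMemClass.coe_zero, zero_add, h0, h0.symm, mul_left_inj,
    true_and, false_and, if_false, reduceCtorEq, and_false]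
  split_ifs <;> norm_num

open Classical in
theorem inner_modelPt_modelPt [IsAddTorsionFree G] (ha : a ∉ S) {x y : S} (hxy : (x : G) = y + a)
    (γ γ' : Γ) :
    inner ℂ (modelPt S a s t y γ) (modelPt S a s t x γ') =
      (if γ * s = γ' then (1 : ℂ) else 0) + if γ * t = γ' then 1 else 0 := by
  have h0 : a ≠ 0 := fun h => ha (h ▸ S.zero_mem)
  have h1 : a + a ≠ 0 := fun h => h0 (by
    rw [← two_nsmul] at h
    exact (nsmul_eq_zero_iff_right two_ne_zero).1 h)
  have e1 : (y : G) ≠ y + a := by simpa using h0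
  have e2 : (y : G) ≠ y + a + a := by rw [add_assoc]; simpa using h1
  have e3 : (y : G) + a ≠ y + a + a := by simpa using h0
  simp only [modelPt, modelVec, Submodule.coe_inner, inner_add_left, inner_add_right,
    inner_basisVec, Prod.mk.injEq, hxy, e1, e2, e3,
    true_and, false_and, if_false, reduceCtorEq, and_false]
  ring

/-- Two functional equations on a kernel `τ` over a group, for elements with `s² = t³ = 1`, which
together force `τ` to be invariant under right multiplication by `s` and by `t`. -/
theorem kernel_invariant (hs : s * s = 1) (ht : t * t * t = 1) {τ : Γ → Γ → ℂ}
    (h1 : ∀ g' g, τ g' (g * s⁻¹) + τ g' (g * t⁻¹) = τ (g' * s) g + τ (g' * t) g)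
    (h2 : ∀ g' g, τ g' (g * s) + τ g' (g * t) = τ (g' * s⁻¹) g + τ (g' * t⁻¹) g) (g : Γ) :
    τ (g * s) (g * s) = τ g g ∧ τ (g * t) (g * t) = τ g g := by
  have hs' : s⁻¹ = s := inv_eq_of_mul_eq_one_left hs
  have ht' : t⁻¹ = t * t := inv_eq_of_mul_eq_one_left ht
  have es : ∀ g : Γ, g * s * s = g := fun g => by rw [mul_assoc, hs, mul_one]
  have et : ∀ g : Γ, g * t * t * t = g := fun g => by
    rw [mul_assoc, mul_assoc, ← mul_assoc t, ht, mul_one]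
  rw [hs', ht'] at h1 h2
  simp only [← mul_assoc] at h1 h2
  -- subtracting eliminates `s`: the difference operator `f ↦ f (· t) - f (· t²)` on the one
  -- variable is minus the one on the other, and applying it twice gives the sum as well
  have d : ∀ g' g, τ g' (g * t) - τ g' (g * t * t) = τ (g' * t * t) g - τ (g' * t) g :=
    fun g' g => by linear_combination h2 g' g - h1 g' g
  have key : ∀ g' g, τ g' (g * t) = τ (g' * t * t) g := fun g' g => by
    have k1 := d g' (g * t)
    have k2 := d g' (g * t * t)
    have k3 := d (g' * t * t) g
    have k4 := d (g' * t) g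
    simp only [et] at k1 k2 k3 k4
    linear_combination (1 / 2) * (d g' g + k1 - k2 + k3 - k4)
  have keys : ∀ g' g, τ g' (g * s) = τ (g' * s) g := fun g' g => by
    linear_combination h2 g' g - key g' g
  exact ⟨by rw [keys, es], by rw [key, et]⟩

section Fibre

variable {M X : Type*} [AddMonoid M]
variable [NormedAddCommGroup X] [InnerProductSpace ℂ X] [CompleteSpace X]
variable {V : M → X →L[ℂ] X} {ξ : M → Γ → X}

/-- The intersection of the kernels of the adjoint shifts is the closed span of the vectors
`ξ 0 γ`: a vector of the former is orthogonal to every vector orthogonal to the latter. -/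
theorem inner_eq_zero_of_star_shift {Γ : Type*} {ξ : M → Γ → X}
    (hshift : ∀ p q γ, V p (ξ q γ) = ξ (p + q) γ)
    (htotal : ∀ x, (∀ p γ, inner ℂ (ξ p γ) x = 0) → x = 0)
    (hpt : ∀ p, p ≠ 0 → ∀ γ, star (V p) (ξ 0 γ) = 0) {x y : X}
    (hx : ∀ p, p ≠ 0 → star (V p) x = 0) (hy : ∀ γ, inner ℂ (ξ 0 γ) y = 0) :
    inner ℂ x y = 0 := by
  set Z : Submodule ℂ X := (Submodule.span ℂ (Set.range (ξ 0))).topologicalClosure with hZ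
  have hZc : IsClosed (Z : Set X) := Submodule.isClosed_topologicalClosure _
  have : CompleteSpace Z := hZc.completeSpace_coe
  have hptZ : ∀ γ, ξ 0 γ ∈ Z := fun γ =>
    Submodule.le_topologicalClosure _ (Submodule.subset_span ⟨γ, rfl⟩)
  have hker : ∀ p, p ≠ 0 → ∀ z ∈ Z, star (V p) z = 0 := by
    intro p hp
    have : Z ≤ LinearMap.ker (star (V p)).toLinearMap := by
      refine Submodule.topologicalClosure_minimal _ (Submodule.span_le.2 ?_)
        (isClosed_singleton.preimage (star (V p)).continuous)
      rintro _ ⟨γ, rfl⟩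
      exact hpt p hp γ
    exact fun z hz => this hz
  have hxZ : x ∈ Z := by
    obtain ⟨x₁, h₁, x₂, h₂, rfl⟩ := Z.exists_add_mem_mem_orthogonal x
    have : x₂ = 0 := by
      refine htotal _ fun p γ => ?_
      by_cases hp : p = 0
      · subst hp
        exact Submodule.inner_right_of_mem_orthogonal (hptZ γ) h₂
      · have h := hx p hp
        rw [map_add, hker p hp x₁ h₁, zero_add] at h
        rw [← add_zero p, ← hshift, ← adjoint_inner_right, ← star_eq_adjoint, h,
          inner_zero_right]
    rw [this, add_zero]
    exact h₁
  have hyZ : y ∈ Zᗮ := by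
    rw [hZ, Submodule.orthogonal_closure, Submodule.mem_orthogonal]
    intro u hu
    induction hu using Submodule.span_induction with
    | mem u hu =>
      obtain ⟨γ, rfl⟩ := hu
      exact hy γ
    | zero => simp
    | add u v _ _ hu hv => rw [inner_add_left, hu, hv, add_zero]
    | smul c u _ hu => rw [inner_smul_left, hu, mul_zero]
  exact Submodule.inner_right_of_mem_orthogonal hxZ hyZ

open Classical in
/-- Let the vectors `ξ p γ` be permuted by the shifts `V p` and satisfy the inner product relations
below. The matrix coefficients, at the vectors `ξ 0 γ`, of an operator commuting with the
shifts and their adjoints are invariant under simultaneous right multiplication by `s` and `t`.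
The equations for `kernel_invariant` come from commutation with `V_y^* V_x` and its adjoint. -/
theorem inner_invariant_of_commute (hs : s * s = 1) (ht : t * t * t = 1)
    (hshift : ∀ p q γ, V p (ξ q γ) = ξ (p + q) γ)
    (htotal : ∀ x, (∀ p γ, inner ℂ (ξ p γ) x = 0) → x = 0)
    (horth : ∀ p, p ≠ 0 → ∀ γ γ', inner ℂ (ξ p γ) (ξ 0 γ') = 0)
    (hadd : ∀ p q : M, p ≠ 0 → p + q ≠ 0)
    (h00 : ∀ γ γ', inner ℂ (ξ 0 γ) (ξ 0 γ') = if γ = γ' then (4 : ℂ) else 0) {x y : M}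
    (hyx : ∀ γ γ', inner ℂ (ξ y γ) (ξ x γ') =
      (if γ * s = γ' then (1 : ℂ) else 0) + if γ * t = γ' then 1 else 0)
    {T : X →L[ℂ] X} (hT : ∀ p, T * V p = V p * T)
    (hT' : ∀ p, T * star (V p) = star (V p) * T) (γ : Γ) :
    inner ℂ (ξ 0 (γ * s)) (T (ξ 0 (γ * s))) = (inner ℂ (ξ 0 γ) (T (ξ 0 γ)) : ℂ) ∧
      inner ℂ (ξ 0 (γ * t)) (T (ξ 0 (γ * t))) = (inner ℂ (ξ 0 γ) (T (ξ 0 γ)) : ℂ) := by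
  have hpt : ∀ p, p ≠ 0 → ∀ γ, star (V p) (ξ 0 γ) = 0 := by
    intro p hp γ
    refine htotal _ fun q γ' => ?_
    rw [star_eq_adjoint, adjoint_inner_right, hshift]
    exact horth _ (hadd p q hp) _ _
  have hTξ : ∀ γ p, p ≠ 0 → star (V p) (T (ξ 0 γ)) = 0 := fun γ p hp => by
    rw [← mul_apply_eq_comp, ← hT', mul_apply_eq_comp, hpt p hp, map_zero]
  have hTsξ : ∀ γ p, p ≠ 0 → star (V p) (adjoint T (ξ 0 γ)) = 0 := fun γ p hp => by
    refine ext_inner_right ℂ fun v => ?_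
    rw [star_eq_adjoint, adjoint_inner_left, adjoint_inner_left, ← mul_apply_eq_comp, hT,
      mul_apply_eq_comp, ← adjoint_inner_left, ← star_eq_adjoint, hpt p hp, inner_zero_left,
      inner_zero_left]
  have hC : ∀ p q v w, inner ℂ (V q v) (V p w) = (inner ℂ v (star (V q) (V p w)) : ℂ) :=
    fun p q v w => by rw [star_eq_adjoint, adjoint_inner_right]
  -- the fibre components of `V_y^* V_x` and of its adjoint
  have fib : ∀ η, (∀ p, p ≠ 0 → star (V p) η = 0) → ∀ γ,
      inner ℂ η (star (V y) (V x (ξ 0 γ))) =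
        (1 / 4 : ℂ) * (inner ℂ η (ξ 0 (γ * s⁻¹)) + inner ℂ η (ξ 0 (γ * t⁻¹))) := by
    intro η hη γ
    have h := inner_eq_zero_of_star_shift (x := η)
      (y := star (V y) (V x (ξ 0 γ)) - (1 / 4 : ℂ) • (ξ 0 (γ * s⁻¹) + ξ 0 (γ * t⁻¹)))
      hshift htotal hpt hη (fun β => by
        rw [inner_sub_right, inner_smul_right, inner_add_right, ← hC, hshift, hshift, add_zero,
          add_zero, hyx, h00, h00]
        simp only [eq_mul_inv_iff_mul_eq]
        split_ifs <;> norm_num)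
    rwa [inner_sub_right, inner_smul_right, inner_add_right, sub_eq_zero] at h
  have fib' : ∀ η, (∀ p, p ≠ 0 → star (V p) η = 0) → ∀ γ,
      inner ℂ η (star (V x) (V y (ξ 0 γ))) =
        (1 / 4 : ℂ) * (inner ℂ η (ξ 0 (γ * s)) + inner ℂ η (ξ 0 (γ * t))) := by
    intro η hη γ
    have h := inner_eq_zero_of_star_shift (x := η)
      (y := star (V x) (V y (ξ 0 γ)) - (1 / 4 : ℂ) • (ξ 0 (γ * s) + ξ 0 (γ * t)))
      hshift htotal hpt hη (fun β => by
        rw [inner_sub_right, inner_smul_right, inner_add_right, ← hC, hshift, hshift, add_zero,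
          add_zero, ← inner_conj_symm, hyx, h00, h00]
        simp only [eq_comm (a := β), map_add, apply_ite (starRingEnd ℂ), map_one, map_zero]
        split_ifs <;> norm_num)
    rwa [inner_sub_right, inner_smul_right, inner_add_right, sub_eq_zero] at h
  have swap : ∀ p q γ' γ, inner ℂ (adjoint T (ξ 0 γ')) (star (V q) (V p (ξ 0 γ))) =
      (starRingEnd ℂ) (inner ℂ (T (ξ 0 γ)) (star (V p) (V q (ξ 0 γ')))) := by
    intro p q γ' γ
    rw [adjoint_inner_left, inner_conj_symm, ← mul_apply_eq_comp T, hT', mul_apply_eq_comp,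
      ← mul_apply_eq_comp T, hT, mul_apply_eq_comp, ← hC, star_eq_adjoint, adjoint_inner_left]
  have conj4 : (starRingEnd ℂ) (1 / 4) = 1 / 4 := by
    rw [map_div₀, map_one, map_ofNat]
  refine kernel_invariant hs ht (τ := fun g' g => inner ℂ (ξ 0 g') (T (ξ 0 g))) ?_ ?_ γ
  · intro g' g
    have h := swap x y g' g
    rw [fib _ (hTsξ g'), fib' _ (hTξ g), map_mul, map_add, inner_conj_symm, inner_conj_symm,
      adjoint_inner_left, adjoint_inner_left, conj4] at h
    exact mul_left_cancel₀ (by norm_num) h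
  · intro g' g
    have h := swap y x g' g
    rw [fib' _ (hTsξ g'), fib _ (hTξ g), map_mul, map_add, inner_conj_symm, inner_conj_symm,
      adjoint_inner_left, adjoint_inner_left, conj4] at h
    exact mul_left_cancel₀ (by norm_num) h

end Fibre

/-- The operators in the commutant of the model representation take the same values in the vector
states at `(0, γ)`, `(0, γ * s)` and `(0, γ * t)`. -/
theorem inner_commutant_invariant [IsAddTorsionFree G] (hS : ContainsNoGroup S)
    (ha : a ∉ S) (hna : -a ∉ S) {x y : S}
    (hxy : (x : G) = y + a) (hs : s * s = 1) (ht : t * t * t = 1)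
    {T : modelSpace S a s t →L[ℂ] modelSpace S a s t}
    (hT : ∀ p, T * modelShift S a s t p = modelShift S a s t p * T)
    (hT' : ∀ p, T * star (modelShift S a s t p) = star (modelShift S a s t p) * T) (γ : Γ) :
    inner ℂ (modelPt S a s t 0 (γ * s)) (T (modelPt S a s t 0 (γ * s))) =
        (inner ℂ (modelPt S a s t 0 γ) (T (modelPt S a s t 0 γ)) : ℂ) ∧
      inner ℂ (modelPt S a s t 0 (γ * t)) (T (modelPt S a s t 0 (γ * t))) =
        (inner ℂ (modelPt S a s t 0 γ) (T (modelPt S a s t 0 γ)) : ℂ) := by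
  refine inner_invariant_of_commute (x := x) (y := y) hs ht modelShift_pt
    (fun _ h => eq_zero_of_inner_modelPt h)
    (fun p hp γ γ' => inner_modelPt_zero_of_ne ha hna hp γ γ') (fun p q hp h => ?_)
    (inner_modelPt_zero_zero ha) (inner_modelPt_modelPt ha hxy) hT hT' γ
  have h' : (p : G) + q = 0 := congrArg Subtype.val h
  have hmem : (p : G) ∈ (S : Set G) ∩ -(S : Set G) :=
    ⟨p.2, by rw [Set.mem_neg, neg_eq_of_add_eq_zero_right h']; exact q.2⟩
  rw [hS] at hmem
  exact hp (Subtype.ext hmem)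

end Trace

/-! ### Failure of invariant means on the free product -/

section PingPong

open Monoid

/-- The free product of two cyclic groups of order six. Order six makes the two factors equal and
provides an element of order two in one of them and an element of order three in the other. -/
abbrev FreeProd : Type := CoprodI fun _ : Bool => Multiplicative (ZMod 6)

/-- The elements of the free product whose reduced word does not start in the factor `i`. -/
def notStarting (i : Bool) : Set FreeProd :=
  {g | (CoprodI.Word.equiv (M := fun _ : Bool => Multiplicative (ZMod 6)) g).fstIdx ≠ some i}

theorem of_mul_not_mem_notStarting {i : Bool} {h : Multiplicative (ZMod 6)} (hh : h ≠ 1)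
    {g : FreeProd} (hg : g ∈ notStarting i) :
    (CoprodI.of (i := i) h : FreeProd) * g ∉ notStarting i := by
  have : CoprodI.Word.equiv (M := fun _ : Bool => Multiplicative (ZMod 6))
      ((CoprodI.of (i := i) h : FreeProd) * g) =
      CoprodI.Word.cons (M := fun _ : Bool => Multiplicative (ZMod 6)) h
        (CoprodI.Word.equiv (M := fun _ : Bool => Multiplicative (ZMod 6)) g)
        (Set.mem_ofPred_eq.mp hg) hh :=
    (mul_smul _ _ _).trans CoprodI.Word.cons_eq_smul.symm
  exact fun hn => hn (by rw [this, CoprodI.Word.fstIdx_cons])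

/-- The generator of order two of the free product, from the first factor. -/
def genTwo : FreeProd := CoprodI.of (i := true) (Multiplicative.ofAdd 3)

/-- The generator of order three of the free product, from the second factor. -/
def genThree : FreeProd := CoprodI.of (i := false) (Multiplicative.ofAdd 2)

theorem genTwo_mul_self : genTwo * genTwo = 1 := by
  rw [genTwo, ← map_mul, ← map_one CoprodI.of]
  rfl

theorem genThree_mul_self : genThree * genThree * genThree = 1 := by
  rw [genThree, ← map_mul, ← map_mul, ← map_one CoprodI.of]
  rfl

/-- There is no finitely additive measure on the free product invariant under `genTwo` and
`genThree`: the sets `notStarting` would have measures at most `1/2` and `1/3`, but cover. -/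
theorem no_invariant_measure (m : Set FreeProd → ℝ) (hm : ∀ A, 0 ≤ m A)
    (hadd : ∀ A B, Disjoint A B → m (A ∪ B) = m A + m B) (huniv : 0 < m Set.univ)
    (h2 : ∀ A, m ((genTwo⁻¹ * ·) ⁻¹' A) = m A) (h3 : ∀ A, m ((genThree⁻¹ * ·) ⁻¹' A) = m A) :
    False := by
  have mono : ∀ {A B : Set FreeProd}, A ⊆ B → m A ≤ m B := fun {A B} h => by
    have := hadd A (B \ A) Set.disjoint_sdiff_right
    rw [Set.union_sdiff_cancel h] at this
    linarith [hm (B \ A)]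
  have hcompl : ∀ A, m A + m Aᶜ = m Set.univ := fun A => by
    rw [← hadd A Aᶜ disjoint_compl_right, Set.union_compl_self]
  have key2 : ∀ g, genTwo⁻¹ * g ∈ notStarting true → g ∉ notStarting true := fun g hg => by
    have := of_mul_not_mem_notStarting (h := Multiplicative.ofAdd (3 : ZMod 6))
      (by decide) hg
    rwa [show (CoprodI.of (i := true) (Multiplicative.ofAdd (3 : ZMod 6)) : FreeProd) = genTwo
      from rfl, mul_inv_cancel_left] at this
  have key3 : ∀ g, genThree⁻¹ * g ∈ notStarting false → g ∉ notStarting false := fun g hg => by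
    have := of_mul_not_mem_notStarting (h := Multiplicative.ofAdd (2 : ZMod 6))
      (by decide) hg
    rwa [show (CoprodI.of (i := false) (Multiplicative.ofAdd (2 : ZMod 6)) : FreeProd) = genThree
      from rfl, mul_inv_cancel_left] at this
  have key3' : ∀ g, genThree⁻¹ * (genThree⁻¹ * g) ∈ notStarting false →
      g ∉ notStarting false := fun g hg => by
    have := of_mul_not_mem_notStarting (h := Multiplicative.ofAdd (4 : ZMod 6))
      (by decide) hg
    rwa [show (CoprodI.of (i := false) (Multiplicative.ofAdd (4 : ZMod 6)) : FreeProd) =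
      genThree * genThree by rw [genThree, ← map_mul]; rfl, mul_assoc, mul_inv_cancel_left,
      mul_inv_cancel_left] at this
  set Q2 := notStarting true
  set Q3 := notStarting false
  have hQ2 : m Q2 ≤ m Q2ᶜ := by
    rw [← h2 Q2]
    exact mono fun g hg => key2 g hg
  have hQ3 : m Q3 + m Q3 ≤ m Q3ᶜ := by
    have hd : Disjoint ((genThree⁻¹ * ·) ⁻¹' Q3)
        ((genThree⁻¹ * ·) ⁻¹' ((genThree⁻¹ * ·) ⁻¹' Q3)) :=
      Set.disjoint_left.2 fun g hg hg' => key3 _ hg' hg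
    have h := hadd _ _ hd
    rw [h3, h3, h3] at h
    rw [← h]
    refine mono (Set.union_subset (fun g hg => key3 g hg) fun g hg => key3' g hg)
  have hcover : Q3ᶜ ⊆ Q2 := by
    intro g hg
    have hg' : (CoprodI.Word.equiv (M := fun _ : Bool => Multiplicative (ZMod 6)) g).fstIdx =
        some false := by
      simpa [Q3, notStarting] using hg
    simp [Q2, notStarting, hg']
  linarith [hcompl Q2, hcompl Q3, mono hcover, hm Q3, hm Q2]

end PingPong

/-! ### An isomorphism forces a total order -/

section Evaluation

open ContinuousLinearMap

variable {G : Type u} [AddCommGroup G] {S : AddSubmonoid G}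

/-- Evaluation of a bounded family of operators at the representation `ρ`. -/
noncomputable def evalRep (ρ : IsometricRep S) :
    RepProduct S →⋆ₐ[ℂ] (ρ.space →L[ℂ] ρ.space) where
  toFun f := f ρ
  map_one' := rfl
  map_mul' _ _ := rfl
  map_zero' := rfl
  map_add' _ _ := rfl
  commutes' _ := rfl
  map_star' _ := rfl

theorem norm_evalRep_le (ρ : IsometricRep S) (f : RepProduct S) : ‖evalRep ρ f‖ ≤ ‖f‖ :=
  lp.norm_apply_le_norm (by simp) f ρ

theorem star_mul_self_of_isometry {X : Type*} [NormedAddCommGroup X] [InnerProductSpace ℂ X]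
    [CompleteSpace X] {V : X →L[ℂ] X} (h : Isometry V) : star V * V = 1 :=
  (norm_map_iff_adjoint_comp_self _).1 ((AddMonoidHomClass.isometry_iff_norm V).1 h)

theorem dense_adjoin {ι A : Type*} [NormedRing A] [StarRing A]
    [CStarRing A] [NormedAlgebra ℂ A] [StarModule ℂ A] (v : ι → A) :
    Dense {z : generatedCStar v | (z : A) ∈ StarAlgebra.adjoin ℂ (Set.range v)} := by
  refine Subtype.dense_iff.2 fun z hz => closure_mono ?_ hz
  exact fun y hy => ⟨⟨y, StarSubalgebra.le_topologicalClosure _ hy⟩, hy, rfl⟩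

/-- A closed property of elements of a generated C*-algebra holds everywhere if it holds for the
generators and is preserved by the star algebra operations. -/
theorem generatedCStar_induction {ι A : Type*} [NormedRing A] [StarRing A]
    [CStarRing A] [NormedAlgebra ℂ A] [StarModule ℂ A] {v : ι → A}
    {P : generatedCStar v → Prop} (g : ι → generatedCStar v) (hg : ∀ i, (g i : A) = v i)
    (gen : ∀ i, P (g i)) (scalar : ∀ r, P (algebraMap ℂ _ r))
    (add : ∀ x y, P x → P y → P (x + y)) (mul : ∀ x y, P x → P y → P (x * y))
    (star : ∀ x, P x → P (star x)) (closed : IsClosed {z | P z}) (z : generatedCStar v) : P z := by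
  have hmem : ∀ z (hz : z ∈ StarAlgebra.adjoin ℂ (Set.range v)),
      P ⟨z, StarSubalgebra.le_topologicalClosure _ hz⟩ := by
    intro z hz
    induction hz using StarAlgebra.adjoin_induction with
    | mem x hx =>
      obtain ⟨i, rfl⟩ := hx
      have : (⟨v i, StarSubalgebra.le_topologicalClosure _
          (StarAlgebra.subset_adjoin ℂ _ ⟨i, rfl⟩)⟩ : generatedCStar v) = g i :=
        Subtype.ext (hg i).symm
      exact this ▸ gen i
    | algebraMap r => exact scalar r
    | add x y hx hy ihx ihy => exact add _ _ ihx ihy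
    | mul x y hx hy ihx ihy => exact mul _ _ ihx ihy
    | star x hx ihx => exact star _ ihx
  have hsub : {z : generatedCStar v | (z : A) ∈ StarAlgebra.adjoin ℂ (Set.range v)} ⊆
      {z | P z} := fun z hz => hmem z hz
  exact closed.closure_subset_iff.2 hsub (dense_adjoin v z)

/-- An operator commuting with the images of the generators and of their adjoints under a
continuous representation commutes with the image of the generated C*-algebra. -/
theorem commute_of_commute_gen {ι A B : Type*} [NormedRing A] [StarRing A]
    [CStarRing A] [NormedAlgebra ℂ A] [StarModule ℂ A] [NormedRing B] [StarRing B]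
    [CStarRing B] [NormedAlgebra ℂ B] [StarModule ℂ B] {v : ι → A}
    (w : generatedCStar v →⋆ₐ[ℂ] B) (hw : Continuous w) (g : ι → generatedCStar v)
    (hg : ∀ i, (g i : A) = v i) {T : B}
    (h1 : ∀ i, T * w (g i) = w (g i) * T) (h2 : ∀ i, T * star (w (g i)) = star (w (g i)) * T)
    (z : generatedCStar v) : T * w z = w z * T := by
  refine (generatedCStar_induction
    (P := fun z => T * w z = w z * T ∧ T * star (w z) = star (w z) * T)
    g hg (fun i => ⟨h1 i, h2 i⟩) ?_ ?_ ?_ ?_ ?_ z).1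
  · intro r
    rw [AlgHomClass.commutes w r, ← algebraMap_star_comm]
    exact ⟨(Algebra.commutes _ _).symm, (Algebra.commutes _ _).symm⟩
  · intro x y hx hy
    rw [map_add, star_add, mul_add, mul_add, add_mul, add_mul, hx.1, hx.2, hy.1, hy.2]
    exact ⟨rfl, rfl⟩
  · intro x y hx hy
    rw [map_mul, star_mul]
    exact ⟨by rw [← mul_assoc, hx.1, mul_assoc, hy.1, mul_assoc],
      by rw [← mul_assoc, hy.2, mul_assoc, hx.2, mul_assoc]⟩
  · intro x hx
    rw [map_star, star_star]
    exact ⟨hx.2, hx.1⟩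
  · have e : {z | T * w z = w z * T ∧ T * star (w z) = star (w z) * T} =
        {z | T * w z = w z * T} ∩ {z | T * star (w z) = star (w z) * T} := rfl
    rw [e]
    exact (isClosed_eq (continuous_const.mul hw) (hw.mul continuous_const)).inter
      (isClosed_eq (continuous_const.mul hw.star) (hw.star.mul continuous_const))

/-- A star homomorphism from a generated C*-algebra to a C*-algebra is continuous. -/
theorem continuous_of_generatedCStar {ι A B : Type*} [CStarAlgebra A] [CStarAlgebra B] {v : ι → A}
    (w : generatedCStar v →⋆ₐ[ℂ] B) : Continuous w := by
  have : IsClosed (generatedCStar v : Set A) :=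
    StarSubalgebra.isClosed_topologicalClosure _
  let _ : CStarAlgebra (generatedCStar v) := StarSubalgebra.cstarAlgebra _
  exact AddMonoidHomClass.continuous_of_bound w 1 fun z => by
    rw [one_mul]
    exact NonUnitalStarAlgHom.norm_apply_le w z

theorem continuous_reducedCStar_hom {X : Type*} [NormedAddCommGroup X] [InnerProductSpace ℂ X]
    [CompleteSpace X] (w : ReducedCStar S →⋆ₐ[ℂ] (X →L[ℂ] X)) : Continuous w :=
  continuous_of_generatedCStar (A := L2 S →L[ℂ] L2 S) w

variable (S) in
/-- The generator `V_a` of the universal C*-algebra. -/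
noncomputable def universalGen (a : S) : UniversalCStar S :=
  ⟨universalIsometry S a, StarSubalgebra.le_topologicalClosure _
    (StarAlgebra.subset_adjoin ℂ _ ⟨a, rfl⟩)⟩

variable (S) in
/-- Evaluation of the universal C*-algebra at the representation `ρ`. -/
noncomputable def evalUniversal (ρ : IsometricRep S) :
    UniversalCStar S →⋆ₐ[ℂ] (ρ.space →L[ℂ] ρ.space) :=
  (evalRep ρ).comp (StarSubalgebra.subtype _)

theorem continuous_evalUniversal (ρ : IsometricRep S) : Continuous (evalUniversal S ρ) :=
  (AddMonoidHomClass.continuous_of_bound (evalRep ρ) 1 fun f => by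
    rw [one_mul]; exact norm_evalRep_le ρ f).comp continuous_subtype_val

theorem evalUniversal_gen (ρ : IsometricRep S) (a : S) :
    evalUniversal S ρ (universalGen S a) = ρ.V a := rfl

end Evaluation

section Obstruction

variable {G : Type u} [AddCommGroup G] {S : AddSubmonoid G}

/-- Given an isomorphism of the two C*-algebras, the commutant of every isometric representation
is the range of a positive unital bimodule map, because it is the commutant of a representation
of the reduced C*-algebra. -/
theorem exists_expectation_of_equiv (Φ : UniversalCStar S ≃⋆ₐ[ℂ] ReducedCStar S)
    (ρ : IsometricRep S) :
    ∃ E : (ρ.space →L[ℂ] ρ.space) → (ρ.space →L[ℂ] ρ.space),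
      (∀ T T', E (T + T') = E T + E T') ∧ E 1 = 1 ∧
      (∀ T, (∀ x, 0 ≤ (inner ℂ (T x) x).re) → ∀ x, 0 ≤ (inner ℂ (E T x) x).re) ∧
      (∀ T a, E T * ρ.V a = ρ.V a * E T ∧ E T * star (ρ.V a) = star (ρ.V a) * E T) ∧
      (∀ L, (∀ a, L * ρ.V a = ρ.V a * L) → (∀ a, L * star (ρ.V a) = star (ρ.V a) * L) →
        ∀ T, E (L * T) = L * E T ∧ E (T * L) = E T * L) := by
  let w : ReducedCStar S →⋆ₐ[ℂ] (ρ.space →L[ℂ] ρ.space) :=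
    (evalUniversal S ρ).comp Φ.symm.toStarAlgHom
  have hw : ∀ z, w z = evalUniversal S ρ (Φ.symm z) := fun z => rfl
  obtain ⟨E, h1, h2, h3, h4, h5⟩ := exists_expectation w
  have hcomm : ∀ T z, E T * w z = w z * E T := fun T z =>
    commute_of_commute_gen w (continuous_reducedCStar_hom w) reducedGen (fun _ => rfl)
      (fun a => (h4 T a).1) (fun a => (h4 T a).2) z
  have hV : ∀ a, w (Φ (universalGen S a)) = ρ.V a := fun a => by
    rw [hw, StarAlgEquiv.symm_apply_apply, evalUniversal_gen]
  have hVs : ∀ a, w (star (Φ (universalGen S a))) = star (ρ.V a) := fun a => by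
    rw [map_star, hV]
  refine ⟨E, h1, h2, h3, fun T a => ⟨?_, ?_⟩, fun L hL hLs => h5 L fun z => ?_⟩
  · rw [← hV, hcomm]
  · rw [← hVs, hcomm]
  · rw [hw]
    exact commute_of_commute_gen (evalUniversal S ρ) (continuous_evalUniversal ρ) (universalGen S)
      (fun _ => rfl) hL hLs _

/-- The model representation as an isometric representation in the sense of the universal
C*-algebra. -/
noncomputable def modelRep (S : AddSubmonoid G) {a : G} (ha : a ∉ S) {Γ : Type} [Group Γ]
    (s t : Γ) : IsometricRep S where
  space := modelSpace S a s t
  nontrivial := by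
    classical
    refine ⟨modelPt S a s t 0 1, 0, fun h => ?_⟩
    have h' := inner_modelPt_zero_zero (S := S) (s := s) (t := t) ha 1 1
    rw [h, if_pos rfl] at h'
    have h0 : inner ℂ (0 : modelSpace S a s t) (0 : modelSpace S a s t) = (0 : ℂ) :=
      inner_zero_left _
    rw [h0] at h'
    norm_num at h'
  V := modelShift S a s t
  isometry p := AddMonoidHomClass.isometry_of_norm _ (norm_modelShift p)
  map_add := modelShift_add

/-- If two elements of `S` are incomparable, the model representation over the free product has no
expectation onto its commutant: composed with a vector state, such a map would give an invariant
mean on the free product. -/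
theorem no_expectation_modelRep [IsAddTorsionFree G] (hS : ContainsNoGroup S) {a : G}
    (ha : a ∉ S) (hna : -a ∉ S) {x y : S} (hxy : (x : G) = y + a)
    (E : (modelSpace S a genTwo genThree →L[ℂ] modelSpace S a genTwo genThree) →
      (modelSpace S a genTwo genThree →L[ℂ] modelSpace S a genTwo genThree))
    (hadd : ∀ T T', E (T + T') = E T + E T') (hone : E 1 = 1)
    (hpos : ∀ T, (∀ x, 0 ≤ (inner ℂ (T x) x).re) → ∀ x, 0 ≤ (inner ℂ (E T x) x).re)
    (hcomm : ∀ T p, E T * modelShift S a genTwo genThree p =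
        modelShift S a genTwo genThree p * E T ∧
      E T * star (modelShift S a genTwo genThree p) =
        star (modelShift S a genTwo genThree p) * E T)
    (hmod : ∀ L, (∀ p, L * modelShift S a genTwo genThree p =
        modelShift S a genTwo genThree p * L) →
      (∀ p, L * star (modelShift S a genTwo genThree p) =
        star (modelShift S a genTwo genThree p) * L) →
      ∀ T, E (L * T) = L * E T ∧ E (T * L) = E T * L) : False := by
  classical
  set ξ := modelPt S a genTwo genThree 0 with hξ
  let c : Set FreeProd → modelSpace S a genTwo genThree →L[ℂ] modelSpace S a genTwo genThree :=
    modelCompress S a genTwo genThree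
  have hc : c = modelCompress S a genTwo genThree := rfl
  have hinv : ∀ T γ, (inner ℂ (E T (ξ (γ * genTwo))) (ξ (γ * genTwo))).re =
        (inner ℂ (E T (ξ γ)) (ξ γ) : ℂ).re ∧
      (inner ℂ (E T (ξ (γ * genThree))) (ξ (γ * genThree))).re =
        (inner ℂ (E T (ξ γ)) (ξ γ) : ℂ).re := by
    intro T γ
    have h := inner_commutant_invariant hS ha hna hxy genTwo_mul_self genThree_mul_self
      (fun p => (hcomm T p).1) (fun p => (hcomm T p).2) γ
    have hre : ∀ u v : modelSpace S a genTwo genThree,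
      (inner ℂ u v : ℂ).re = (inner ℂ v u : ℂ).re := fun u v => inner_re_symm (𝕜 := ℂ) u v
    rw [hre, hre _ (ξ γ), hre _ (ξ (γ * genThree))]
    exact ⟨congrArg Complex.re h.1, congrArg Complex.re h.2⟩
  have htrans : ∀ g B, (inner ℂ (E (c ((g⁻¹ * ·) ⁻¹' B)) (ξ 1)) (ξ 1)).re =
      (inner ℂ (E (c B) (ξ g⁻¹)) (ξ g⁻¹) : ℂ).re := by
    intro g B
    have hL := hmod (modelLeft S a genTwo genThree g) (modelLeft_mul_modelShift g)
      (modelLeft_mul_star_modelShift g)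
    have h1 : E (c ((g⁻¹ * ·) ⁻¹' B)) * modelLeft S a genTwo genThree g =
        modelLeft S a genTwo genThree g * E (c B) := by
      rw [← (hL _).2, ← (hL _).1, hc, modelLeft_mul_modelCompress]
    have h2 : modelLeft S a genTwo genThree g (ξ g⁻¹) = ξ 1 := by
      rw [hξ, modelLeft_pt, mul_inv_cancel]
    have h3 : E (c ((g⁻¹ * ·) ⁻¹' B)) (ξ 1) =
        modelLeft S a genTwo genThree g (E (c B) (ξ g⁻¹)) := by
      rw [← h2]
      exact congrArg (fun Z : modelSpace S a genTwo genThree →L[ℂ] _ => Z (ξ g⁻¹)) h1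
    rw [h3, ← h2]
    have h4 := LinearIsometry.inner_map_map (𝕜 := ℂ)
      ⟨(modelLeft S a genTwo genThree g).toLinearMap, norm_modelLeft g⟩
      (E (c B) (ξ g⁻¹)) (ξ g⁻¹)
    exact congrArg Complex.re h4
  refine no_invariant_measure (fun B => (inner ℂ (E (c B) (ξ 1)) (ξ 1) : ℂ).re)
    (fun B => hpos _ (modelCompress_nonneg B) _) (fun A B hAB => ?_) ?_ (fun B => ?_)
    (fun B => ?_)
  · simp only [hc, modelCompress_union hAB, hadd]
    exact (congrArg Complex.re (inner_add_left (𝕜 := ℂ) _ _ _)).trans (Complex.add_re _ _)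
  · simp only [hc, modelCompress_univ, hone]
    have h := inner_modelPt_zero_zero (S := S) (s := genTwo) (t := genThree) ha 1 1
    rw [if_pos rfl] at h
    have h' : (inner ℂ ((1 : modelSpace S a genTwo genThree →L[ℂ] _) (ξ 1)) (ξ 1) : ℂ) = 4 := h
    rw [h']
    norm_num
  · have h := (hinv (c B) genTwo⁻¹).1
    rw [inv_mul_cancel] at h
    exact (htrans genTwo B).trans h.symm
  · have h := (hinv (c B) genThree⁻¹).2
    rw [inv_mul_cancel] at h
    exact (htrans genThree B).trans h.symm

/-- Comparability of all pairs makes `S ∪ (-S)` closed under addition. -/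
theorem isTotallyOrdered_of_forall_sub (hS : ContainsNoGroup S)
    (h : ∀ x y : S, (x : G) - y ∈ S ∨ (y : G) - x ∈ S) : IsTotallyOrdered S := by
  have hunion : ∀ {g : G}, (g ∈ S ∨ -g ∈ S) ↔ g ∈ (S : Set G) ∪ -(S : Set G) := Iff.rfl
  refine ⟨⟨⟨⟨(S : Set G) ∪ -(S : Set G), ?_⟩, ?_⟩, ?_⟩, rfl, hS⟩
  · intro g g' hg hg'
    rw [← hunion] at hg hg' ⊢
    rcases hg with hg | hg <;> rcases hg' with hg' | hg'
    · exact Or.inl (S.add_mem hg hg')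
    · simpa [sub_eq_add_neg, add_comm] using h ⟨g, hg⟩ ⟨-g', hg'⟩
    · simpa [sub_eq_add_neg, add_comm] using h ⟨g', hg'⟩ ⟨-g, hg⟩
    · exact Or.inr (by rw [neg_add]; exact S.add_mem hg hg')
  · exact Or.inl S.zero_mem
  · intro g hg
    rw [← hunion] at hg ⊢
    rw [neg_neg]
    exact hg.symm

/-- An isomorphism of any kind, not only the canonical one, forces a total order: it provides
expectations onto the commutants of all isometric representations, and two incomparable elements
give a model representation without one. -/
theorem isTotallyOrdered_of_equiv [IsAddTorsionFree G] (hS : ContainsNoGroup S)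
    (Φ : UniversalCStar S ≃⋆ₐ[ℂ] ReducedCStar S) : IsTotallyOrdered S := by
  refine isTotallyOrdered_of_forall_sub hS fun x y => ?_
  by_contra! hxy
  have ha : (x : G) - y ∉ S := hxy.1
  obtain ⟨E, h1, h2, h3, h4, h5⟩ :=
    exists_expectation_of_equiv Φ (modelRep S ha genTwo genThree)
  exact no_expectation_modelRep hS ha (by rw [neg_sub]; exact hxy.2) (x := x) (y := y) (by abel)
    E h1 h2 h3 h4 h5

end Obstruction

/-! ### Isometric representations of totally ordered semigroups -/

section Chain

open ContinuousLinearMap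

variable {M : Type*} [AddCancelCommMonoid M] [LinearOrder M] [CanonicallyOrderedAdd M]
variable {X : Type*} [NormedAddCommGroup X] [InnerProductSpace ℂ X] [CompleteSpace X]
variable {V : M → X →L[ℂ] X}

theorem rangeProj_mul_rangeProj (hadd : ∀ a b, V (a + b) = V a * V b)
    (hVV : ∀ a, star (V a) * V a = 1) {r r' : M} (h : r ≤ r') :
    V r * star (V r) * (V r' * star (V r')) = V r' * star (V r') := by
  obtain ⟨c, rfl⟩ := exists_add_of_le h
  rw [hadd]
  calc _ = V r * (star (V r) * V r) * V c * star (V r * V c) := by simp only [mul_assoc]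
    _ = _ := by rw [hVV, mul_one]

theorem rangeProj_mul_rangeProj' (hadd : ∀ a b, V (a + b) = V a * V b)
    (hVV : ∀ a, star (V a) * V a = 1) {r r' : M} (h : r ≤ r') :
    V r' * star (V r') * (V r * star (V r)) = V r' * star (V r') := by
  have := congrArg star (rangeProj_mul_rangeProj hadd hVV h)
  simpa only [star_mul, star_star] using this

/-- The range projections of the isometries decrease along the order, so over a finite set `R`
they are the tail sums of pairwise differences, which are again projections. -/
theorem exists_chain_projections (hadd : ∀ a b, V (a + b) = V a * V b)
    (hVV : ∀ a, star (V a) * V a = 1) (R : Finset M) :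
    ∃ Z : M → X →L[ℂ] X, (∀ r ∈ R, star (Z r) * Z r = Z r) ∧
      ∀ r ∈ R, ∑ r' ∈ R with r ≤ r', Z r' = V r * star (V r) := by
  induction R using Finset.induction_on_min with
  | empty => exact ⟨0, by simp, by simp⟩
  | insert a s ha ih =>
    obtain ⟨Z, hZ, hsum⟩ := ih
    have has : a ∉ s := fun h => lt_irrefl _ (ha a h)
    set Q := ∑ r ∈ s, Z r with hQ
    have hQcases : Q = 0 ∨ ∃ r ∈ s, Q = V r * star (V r) := by
      rcases s.eq_empty_or_nonempty with rfl | hs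
      · left; simp [hQ]
      · refine Or.inr ⟨s.min' hs, s.min'_mem hs, ?_⟩
        rw [← hsum _ (s.min'_mem hs), Finset.filter_true_of_mem fun r hr => s.min'_le r hr]
    have hpp : ∀ r, V r * star (V r) * (V r * star (V r)) = V r * star (V r) := fun r =>
      rangeProj_mul_rangeProj hadd hVV le_rfl
    refine ⟨Function.update Z a (V a * star (V a) - Q), ?_, ?_⟩
    · intro r hr
      rcases Finset.mem_insert.1 hr with rfl | hr
      · rw [Function.update_self]
        rcases hQcases with h | ⟨r', hr', h⟩
        · rw [h, sub_zero, star_mul, star_star, hpp]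
        · have hle := (ha r' hr').le
          rw [h, star_sub, star_mul, star_mul, star_star, star_star, sub_mul, mul_sub, mul_sub,
            hpp, hpp, rangeProj_mul_rangeProj hadd hVV hle,
            rangeProj_mul_rangeProj' hadd hVV hle, sub_self, sub_zero]
      · rw [Function.update_of_ne (ne_of_mem_of_not_mem hr has), hZ r hr]
    · intro r hr
      have hold : ∀ t : Finset M, t ⊆ s →
          ∑ r' ∈ t, Function.update Z a (V a * star (V a) - Q) r' = ∑ r' ∈ t, Z r' :=
        fun t ht => Finset.sum_congr rfl fun r' hr' =>
          Function.update_of_ne (ne_of_mem_of_not_mem (ht hr') has) _ _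
      rcases Finset.mem_insert.1 hr with rfl | hr
      · rw [Finset.filter_true_of_mem, Finset.sum_insert has, Function.update_self,
          hold s (Finset.Subset.refl s), ← hQ, sub_add_cancel]
        intro r' hr'
        rcases Finset.mem_insert.1 hr' with rfl | hr'
        · exact le_rfl
        · exact (ha r' hr').le
      · rw [Finset.filter_insert, if_neg (not_le.2 (ha r hr)), hold _ (Finset.filter_subset _ _),
          hsum r hr]

theorem norm_sq_eq_of_star_mul_self {Z : X →L[ℂ] X} (h : star Z * Z = Z) (y : X) :
    ‖Z y‖ ^ 2 = (inner ℂ y (Z y) : ℂ).re := by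
  have h1 : inner ℂ (Z y) (Z y) = (inner ℂ y (Z y) : ℂ) := by
    rw [← adjoint_inner_right, ← star_eq_adjoint, ← mul_apply_eq_comp, h]
  rw [← h1]
  exact norm_sq_eq_re_inner (𝕜 := ℂ) _

/-- Differences of a decreasing chain of projections satisfy Bessel's inequality: their sum is the
largest projection of the chain. -/
theorem sum_norm_chain_le {M : Type*} [LinearOrder M] {V : M → X →L[ℂ] X}
    (hVV : ∀ a, star (V a) * V a = 1) {R : Finset M} {Z : M → X →L[ℂ] X}
    (hZ : ∀ r ∈ R, star (Z r) * Z r = Z r)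
    (hsum : ∀ r ∈ R, ∑ r' ∈ R with r ≤ r', Z r' = V r * star (V r)) (y : X) :
    ∑ r ∈ R, ‖Z r y‖ ^ 2 ≤ ‖y‖ ^ 2 := by
  rcases R.eq_empty_or_nonempty with rfl | hR
  · simp
  have h := hsum _ (R.min'_mem hR)
  rw [Finset.filter_true_of_mem fun r hr => R.min'_le r hr] at h
  have hP : star (V (R.min' hR) * star (V (R.min' hR))) * (V (R.min' hR) * star (V (R.min' hR))) =
      V (R.min' hR) * star (V (R.min' hR)) := by
    rw [star_mul, star_star]
    calc _ = V (R.min' hR) * (star (V (R.min' hR)) * V (R.min' hR)) * star (V (R.min' hR)) := by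
          simp only [mul_assoc]
      _ = _ := by rw [hVV, mul_one]
  calc ∑ r ∈ R, ‖Z r y‖ ^ 2 = (inner ℂ y ((V (R.min' hR) * star (V (R.min' hR))) y) : ℂ).re := by
        rw [← h, sum_apply, inner_sum, Complex.re_sum]
        exact Finset.sum_congr rfl fun r hr => norm_sq_eq_of_star_mul_self (hZ r hr) y
    _ = ‖(V (R.min' hR) * star (V (R.min' hR))) y‖ ^ 2 := (norm_sq_eq_of_star_mul_self hP y).symm
    _ ≤ ‖y‖ ^ 2 := by
        have h1 : ‖(V (R.min' hR) * star (V (R.min' hR))) y‖ ^ 2 ≤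
            ‖y‖ * ‖(V (R.min' hR) * star (V (R.min' hR))) y‖ := by
          rw [norm_sq_eq_of_star_mul_self hP y]
          exact (Complex.re_le_norm _).trans (norm_inner_le_norm _ _)
        nlinarith [norm_nonneg y, norm_nonneg ((V (R.min' hR) * star (V (R.min' hR))) y),
          sq_nonneg (‖y‖ - ‖(V (R.min' hR) * star (V (R.min' hR))) y‖)]

end Chain

section Gram

/-- Expanding the vectors `y k` in an orthonormal basis turns the sum into one of diagonal matrix
coefficients `⟪E j, T (E j)⟫`. -/
theorem norm_sum_gram_le_of_finiteDimensional {ι W H : Type*} [NormedAddCommGroup W]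
    [InnerProductSpace ℂ W] [FiniteDimensional ℂ W] [NormedAddCommGroup H] [InnerProductSpace ℂ H]
    (F : Finset ι) (y : ι → W) (e : ι → H) (T : H →L[ℂ] H)
    (he : ∀ c : ι → ℂ, ‖∑ k ∈ F, c k • e k‖ ^ 2 ≤ ∑ k ∈ F, ‖c k‖ ^ 2) :
    ‖∑ h ∈ F, ∑ k ∈ F, inner ℂ (y h) (y k) * inner ℂ (e h) (T (e k))‖ ≤
      ‖T‖ * ∑ k ∈ F, ‖y k‖ ^ 2 := by
  let b := stdOrthonormalBasis ℂ W
  let E : Fin (Module.finrank ℂ W) → H := fun j => ∑ k ∈ F, (inner ℂ (b j) (y k) : ℂ) • e k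
  have h1 : ∑ h ∈ F, ∑ k ∈ F, inner ℂ (y h) (y k) * inner ℂ (e h) (T (e k)) =
      ∑ j, inner ℂ (E j) (T (E j)) := by
    have : ∀ j, inner ℂ (E j) (T (E j)) = ∑ h ∈ F, ∑ k ∈ F,
        inner ℂ (y h) (b j) * inner ℂ (b j) (y k) * inner ℂ (e h) (T (e k)) := by
      intro j
      simp only [E, map_sum, map_smul, sum_inner, inner_sum, inner_smul_left, inner_smul_right,
        inner_conj_symm, Finset.mul_sum]
      rw [Finset.sum_comm]
      exact Finset.sum_congr rfl fun h _ => Finset.sum_congr rfl fun k _ => by ring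
    simp only [this]
    conv_rhs => rw [Finset.sum_comm]
    refine Finset.sum_congr rfl fun h _ => ?_
    conv_rhs => rw [Finset.sum_comm]
    refine Finset.sum_congr rfl fun k _ => ?_
    rw [← Finset.sum_mul, b.sum_inner_mul_inner]
  rw [h1]
  calc ‖∑ j, inner ℂ (E j) (T (E j))‖ ≤ ∑ j, ‖T‖ * ‖E j‖ ^ 2 := by
        refine (norm_sum_le _ _).trans (Finset.sum_le_sum fun j _ => ?_)
        refine (norm_inner_le_norm _ _).trans ?_
        have := T.le_opNorm (E j)
        nlinarith [norm_nonneg (E j)]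
    _ ≤ ∑ j, ‖T‖ * ∑ k ∈ F, ‖inner ℂ (b j) (y k)‖ ^ 2 :=
        Finset.sum_le_sum fun j _ => mul_le_mul_of_nonneg_left (he _) (norm_nonneg _)
    _ = ‖T‖ * ∑ k ∈ F, ‖y k‖ ^ 2 := by
        rw [← Finset.mul_sum, Finset.sum_comm]
        congr 1
        exact Finset.sum_congr rfl fun k _ => b.sum_sq_norm_inner_right (y k)

/-- The entrywise product of a Gram matrix with the matrix of an operator is bounded by the
operator norm. Only the span of the finitely many vectors `y k` matters. -/
theorem norm_sum_gram_le {ι X H : Type*} [NormedAddCommGroup X]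
    [InnerProductSpace ℂ X] [NormedAddCommGroup H] [InnerProductSpace ℂ H]
    (F : Finset ι) (y : ι → X) (e : ι → H) (T : H →L[ℂ] H)
    (he : ∀ c : ι → ℂ, ‖∑ k ∈ F, c k • e k‖ ^ 2 ≤ ∑ k ∈ F, ‖c k‖ ^ 2) :
    ‖∑ h ∈ F, ∑ k ∈ F, inner ℂ (y h) (y k) * inner ℂ (e h) (T (e k))‖ ≤
      ‖T‖ * ∑ k ∈ F, ‖y k‖ ^ 2 := by
  set W : Submodule ℂ X := Submodule.span ℂ (y '' F) with hW
  have : FiniteDimensional ℂ W :=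
    FiniteDimensional.span_of_finite ℂ (F.finite_toSet.image y)
  classical
  let y' : ι → W := fun k => if hk : k ∈ F then ⟨y k, Submodule.subset_span ⟨k, hk, rfl⟩⟩ else 0
  have hy' : ∀ k ∈ F, (y' k : X) = y k := fun k hk => by simp [y', hk]
  have h := norm_sum_gram_le_of_finiteDimensional F y' e T he
  have h1 : ∑ h ∈ F, ∑ k ∈ F, inner ℂ (y h) (y k) * inner ℂ (e h) (T (e k)) =
      ∑ h ∈ F, ∑ k ∈ F, inner ℂ (y' h) (y' k) * inner ℂ (e h) (T (e k)) :=
    Finset.sum_congr rfl fun h hh => Finset.sum_congr rfl fun k hk => by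
      rw [Submodule.coe_inner, hy' h hh, hy' k hk]
  have h2 : ∑ k ∈ F, ‖y k‖ ^ 2 = ∑ k ∈ F, ‖y' k‖ ^ 2 :=
    Finset.sum_congr rfl fun k hk => by rw [Submodule.coe_norm, hy' k hk]
  rw [h1, h2]
  exact h

end Gram

/-! ### Comparison with a representation by shifts -/

section Comparison

open ContinuousLinearMap

variable {M : Type*} [AddCancelCommMonoid M]

/-- Coincidences `h + a = k + b` in `F` correspond to common points of the translates of `F`. -/
theorem card_filter_add_eq [DecidableEq M] (F : Finset M) (a b : M) :
    Finset.card {p ∈ F ×ˢ F | p.1 + a = p.2 + b} =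
      Finset.card (F.image (· + a) ∩ F.image (· + b)) := by
  refine Finset.card_nbij (fun p => p.1 + a) ?_ ?_ ?_
  · rintro ⟨h, k⟩ hp
    simp only [Finset.coe_filter, Finset.mem_product, Set.mem_ofPred_eq] at hp
    simp only [Finset.coe_inter, Finset.coe_image, Set.mem_inter_iff, Set.mem_image,
      Finset.mem_coe]
    exact ⟨⟨h, hp.1.1, rfl⟩, ⟨k, hp.1.2, hp.2.symm⟩⟩
  · rintro ⟨h, k⟩ hp ⟨h', k'⟩ hp' heq
    simp only [Finset.coe_filter, Finset.mem_product, Set.mem_ofPred_eq] at hp hp' heq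
    have h1 := add_right_cancel heq
    have h2 : k = k' := add_right_cancel (hp.2.symm.trans (heq.trans hp'.2))
    rw [h1, h2]
  · intro m hm
    simp only [Finset.coe_inter, Finset.coe_image, Set.mem_inter_iff, Set.mem_image,
      Finset.mem_coe] at hm
    obtain ⟨⟨h, hh, rfl⟩, ⟨k, hk, hkh⟩⟩ := hm
    exact ⟨(h, k), by simp [hh, hk, hkh], rfl⟩

variable [LinearOrder M]
variable {X : Type*} [NormedAddCommGroup X] [InnerProductSpace ℂ X] [CompleteSpace X]
variable {H : Type*} [NormedAddCommGroup H] [InnerProductSpace ℂ H] [CompleteSpace H]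
variable {V : M → X →L[ℂ] X} {L : M → H →L[ℂ] H} {d : M → H}

/-- For fixed `r` the vectors `star (L k) (d r)` are orthonormal or zero. -/
theorem norm_sum_left_shift_le {M : Type*} [LinearOrder M] {L : M → H →L[ℂ] H} {d : M → H}
    (hd : ∀ p q r, (inner ℂ (star (L p) (d r)) (star (L q) (d r)) : ℂ) =
      if p = q ∧ p ≤ r then 1 else 0) (F : Finset M) (r : M) (c : M → ℂ) :
    ‖∑ k ∈ F, c k • star (L k) (d r)‖ ^ 2 ≤ ∑ k ∈ F, ‖c k‖ ^ 2 := by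
  have h : (inner ℂ (∑ k ∈ F, c k • star (L k) (d r)) (∑ k ∈ F, c k • star (L k) (d r)) : ℂ) =
      ∑ k ∈ F, if k ≤ r then ((‖c k‖ ^ 2 : ℝ) : ℂ) else 0 := by
    simp only [sum_inner, inner_sum, inner_smul_left, inner_smul_right, hd]
    refine Finset.sum_congr rfl fun k hk => ?_
    rw [Finset.sum_eq_single k]
    · by_cases hkr : k ≤ r
      · simp [hkr, ← Complex.normSq_eq_norm_sq, Complex.normSq_eq_conj_mul_self, mul_comm]
      · simp [hkr]
    · intro q _ hq
      simp [hq]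
    · exact fun h => absurd hk h
  rw [norm_sq_eq_re_inner (𝕜 := ℂ), h]
  simp only [RCLike.re_to_complex, Complex.re_sum]
  refine Finset.sum_le_sum fun k _ => ?_
  split_ifs
  · exact (Complex.ofReal_re _).le
  · simp

/-- Averaging a product of matrix coefficients over `F` and over the chain of projections `Z r`
recovers the matrix coefficient of `V a * star (V b)`, with the weight counting the coincidences
`h + a = k + b` in `F`. -/
theorem sum_gram_monomial (hadd : ∀ a b, V (a + b) = V a * V b)
    (hVV : ∀ a, star (V a) * V a = 1) (hLadd : ∀ a b, L (a + b) = L a * L b)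
    (hd : ∀ p q r, (inner ℂ (star (L p) (d r)) (star (L q) (d r)) : ℂ) =
      if p = q ∧ p ≤ r then 1 else 0)
    {F R : Finset M} {Z : M → X →L[ℂ] X}
    (hZ : ∀ r ∈ R, star (Z r) * Z r = Z r)
    (hsum : ∀ r ∈ R, ∑ r' ∈ R with r ≤ r', Z r' = V r * star (V r))
    (a b : M) (hR : ∀ h ∈ F, h + a ∈ R) (x : X) :
    ∑ r ∈ R, ∑ h ∈ F, ∑ k ∈ F, inner ℂ (Z r (V h x)) (Z r (V k x)) *
        inner ℂ (star (L h) (d r)) ((L a * star (L b)) (star (L k) (d r))) =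
      (Finset.card (F.image (· + a) ∩ F.image (· + b)) : ℂ) * inner ℂ x ((V a * star (V b)) x) := by
  have hcoef : ∀ r h k, (inner ℂ (star (L h) (d r)) ((L a * star (L b)) (star (L k) (d r))) : ℂ) =
      if h + a = k + b ∧ h + a ≤ r then 1 else 0 := by
    intro r h k
    rw [← hd, hLadd, hLadd, star_mul, star_mul, mul_apply_eq_comp, mul_apply_eq_comp,
      mul_apply_eq_comp, star_eq_adjoint (L a), adjoint_inner_left]
  have hproj : ∀ r ∈ R, ∀ y z : X, (inner ℂ (Z r y) (Z r z) : ℂ) = inner ℂ y (Z r z) := by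
    intro r hr y z
    rw [← adjoint_inner_right, ← star_eq_adjoint, ← mul_apply_eq_comp, hZ r hr]
  have hterm : ∀ h ∈ F, ∀ k ∈ F, ∑ r ∈ R, inner ℂ (Z r (V h x)) (Z r (V k x)) *
        inner ℂ (star (L h) (d r)) ((L a * star (L b)) (star (L k) (d r))) =
      if h + a = k + b then inner ℂ x ((V a * star (V b)) x) else 0 := by
    intro h hh k hk
    simp only [hcoef]
    by_cases hab : h + a = k + b
    · simp only [hab, true_and, mul_ite, mul_one, mul_zero, if_true]
      rw [← Finset.sum_filter]
      have h1 : V (k + b) * star (V (k + b)) * V k = V h * (V a * star (V b)) := by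
        calc _ = V (h + a) * star (V (k + b)) * V k := by rw [hab]
          _ = V h * V a * (star (V b) * (star (V k) * V k)) := by
            rw [hadd, hadd, star_mul]; simp only [mul_assoc]
          _ = _ := by rw [hVV, mul_one, mul_assoc]
      calc _ = ∑ r ∈ R with k + b ≤ r, inner ℂ (V h x) (Z r (V k x)) :=
            Finset.sum_congr rfl fun r hr => hproj r (Finset.mem_filter.1 hr).1 _ _
        _ = inner ℂ (V h x) ((V (k + b) * star (V (k + b)) * V k) x) := by
            rw [← hsum _ (hab ▸ hR h hh), mul_apply_eq_comp, sum_apply, inner_sum]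
        _ = _ := by
            rw [h1, mul_apply_eq_comp, ← adjoint_inner_right, ← star_eq_adjoint,
              ← mul_apply_eq_comp, hVV, one_apply_eq_self]
    · simp [hab]
  calc _ = ∑ h ∈ F, ∑ k ∈ F, ∑ r ∈ R, inner ℂ (Z r (V h x)) (Z r (V k x)) *
        inner ℂ (star (L h) (d r)) ((L a * star (L b)) (star (L k) (d r))) := by
        rw [Finset.sum_comm]
        exact Finset.sum_congr rfl fun h _ => Finset.sum_comm
    _ = ∑ h ∈ F, ∑ k ∈ F, if h + a = k + b then inner ℂ x ((V a * star (V b)) x) else 0 :=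
        Finset.sum_congr rfl fun h hh => Finset.sum_congr rfl fun k hk => hterm h hh k hk
    _ = _ := by
        rw [← Finset.sum_product', ← Finset.sum_filter, Finset.sum_const, card_filter_add_eq,
          nsmul_eq_mul]

/-- A linear combination of the products `V a * star (V b)` has matrix coefficients bounded by
the norm of the same linear combination in the representation `L`. Summing `sum_gram_monomial`
over the linear combination gives an expression controlled by the Gram matrix bound, and over a
Følner set the weights of all its terms are almost equal to the number of elements. -/
theorem norm_inner_sum_monomial_le [CanonicallyOrderedAdd M]
    (hadd : ∀ a b, V (a + b) = V a * V b)
    (hVV : ∀ a, star (V a) * V a = 1) (hLadd : ∀ a b, L (a + b) = L a * L b)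
    (hd : ∀ p q r, (inner ℂ (star (L p) (d r)) (star (L q) (d r)) : ℂ) =
      if p = q ∧ p ≤ r then 1 else 0)
    (I : Finset (M × M)) (c : M × M → ℂ) (x : X) :
    ‖inner ℂ x ((∑ i ∈ I, c i • (V i.1 * star (V i.2))) x)‖ ≤
      ‖∑ i ∈ I, c i • (L i.1 * star (L i.2))‖ * ‖x‖ ^ 2 := by
  set T := ∑ i ∈ I, c i • (L i.1 * star (L i.2)) with hT
  set m : M × M → ℂ := fun i => inner ℂ x ((V i.1 * star (V i.2)) x) with hm
  have hexp : (inner ℂ x ((∑ i ∈ I, c i • (V i.1 * star (V i.2))) x) : ℂ) = ∑ i ∈ I, c i * m i := by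
    simp only [sum_apply, inner_sum, smul_apply, inner_smul_right, hm]
  rw [hexp]
  set C := ∑ i ∈ I, ‖c i * m i‖ with hC
  have hC0 : 0 ≤ C := Finset.sum_nonneg fun _ _ => norm_nonneg _
  have main : ∀ ε : ℝ, 0 < ε → ‖∑ i ∈ I, c i * m i‖ ≤ ‖T‖ * ‖x‖ ^ 2 + ε * C := by
    intro ε hε
    obtain ⟨F, hF, hFA⟩ := exists_folner (I.image Prod.fst ∪ I.image Prod.snd) hε
    -- the chain has to contain every sum `h + a` that occurs
    obtain ⟨Z, hZ, hsum⟩ := exists_chain_projections hadd hVV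
      ((I ×ˢ F).image fun p => p.2 + p.1.1)
    set R := (I ×ˢ F).image fun p => p.2 + p.1.1
    have hcard : (0 : ℝ) < F.card := by exact_mod_cast hF.card_pos
    set N : M × M → ℕ := fun i => Finset.card (F.image (· + i.1) ∩ F.image (· + i.2)) with hN
    have hNle : ∀ i, (N i : ℝ) ≤ F.card := fun i => by
      exact_mod_cast (Finset.card_le_card Finset.inter_subset_left).trans Finset.card_image_le
    have hNge : ∀ i ∈ I, (1 - ε) * F.card ≤ N i := fun i hi => by
      convert hFA i.1 (Finset.mem_union_left _ (Finset.mem_image_of_mem _ hi)) i.2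
        (Finset.mem_union_right _ (Finset.mem_image_of_mem _ hi))
    have hident : ∑ i ∈ I, c i * ((N i : ℂ) * m i) =
        ∑ r ∈ R, ∑ h ∈ F, ∑ k ∈ F, inner ℂ (Z r (V h x)) (Z r (V k x)) *
          inner ℂ (star (L h) (d r)) (T (star (L k) (d r))) := by
      have h1 : ∀ i ∈ I, (N i : ℂ) * m i =
          ∑ r ∈ R, ∑ h ∈ F, ∑ k ∈ F, inner ℂ (Z r (V h x)) (Z r (V k x)) *
            inner ℂ (star (L h) (d r)) ((L i.1 * star (L i.2)) (star (L k) (d r))) :=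
        fun i hi => (sum_gram_monomial hadd hVV hLadd hd hZ hsum i.1 i.2 (fun h hh =>
          Finset.mem_image.2 ⟨(i, h), Finset.mem_product.2 ⟨hi, hh⟩, rfl⟩) x).symm
      rw [Finset.sum_congr rfl fun i hi => by rw [h1 i hi]]
      simp only [hT, sum_apply, smul_apply, inner_sum, inner_smul_right, Finset.mul_sum]
      rw [Finset.sum_comm]
      refine Finset.sum_congr rfl fun r _ => ?_
      rw [Finset.sum_comm]
      refine Finset.sum_congr rfl fun h _ => ?_
      rw [Finset.sum_comm]
      refine Finset.sum_congr rfl fun k _ => Finset.sum_congr rfl fun i _ => ?_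
      ring
    have hbound : ‖∑ i ∈ I, c i * ((N i : ℂ) * m i)‖ ≤ ‖T‖ * (F.card * ‖x‖ ^ 2) := by
      rw [hident]
      calc _ ≤ ∑ r ∈ R, ‖T‖ * ∑ k ∈ F, ‖Z r (V k x)‖ ^ 2 :=
            (norm_sum_le _ _).trans (Finset.sum_le_sum fun r _ =>
              norm_sum_gram_le F _ _ T (norm_sum_left_shift_le hd F r))
        _ = ‖T‖ * ∑ k ∈ F, ∑ r ∈ R, ‖Z r (V k x)‖ ^ 2 := by
            rw [← Finset.mul_sum, Finset.sum_comm]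
        _ ≤ ‖T‖ * ∑ k ∈ F, ‖x‖ ^ 2 := by
            refine mul_le_mul_of_nonneg_left (Finset.sum_le_sum fun k _ => ?_) (norm_nonneg _)
            refine (sum_norm_chain_le hVV hZ hsum (V k x)).trans_eq ?_
            rw [(norm_map_iff_adjoint_comp_self (V k)).2 (hVV k)]
        _ = _ := by rw [Finset.sum_const, nsmul_eq_mul]
    have hdiff : ‖∑ i ∈ I, c i * (((F.card : ℂ) - N i) * m i)‖ ≤ F.card * (ε * C) := by
      refine (norm_sum_le _ _).trans ?_
      rw [hC, Finset.mul_sum, Finset.mul_sum]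
      refine Finset.sum_le_sum fun i hi => ?_
      have h1 : ‖(F.card : ℂ) - N i‖ ≤ F.card * ε := by
        have : ((F.card : ℂ) - N i) = (((F.card : ℝ) - N i : ℝ) : ℂ) := by push_cast; rfl
        rw [this, Complex.norm_real, Real.norm_of_nonneg (sub_nonneg.2 (hNle i))]
        linarith [hNge i hi]
      rw [norm_mul, norm_mul, norm_mul]
      have := mul_le_mul_of_nonneg_right h1 (mul_nonneg (norm_nonneg (c i)) (norm_nonneg (m i)))
      linarith
    have hsplit : (F.card : ℂ) * ∑ i ∈ I, c i * m i =
        ∑ i ∈ I, c i * ((N i : ℂ) * m i) + ∑ i ∈ I, c i * (((F.card : ℂ) - N i) * m i) := by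
      rw [← Finset.sum_add_distrib, Finset.mul_sum]
      exact Finset.sum_congr rfl fun i _ => by ring
    have hfin : F.card * ‖∑ i ∈ I, c i * m i‖ ≤ F.card * (‖T‖ * ‖x‖ ^ 2 + ε * C) := by
      calc (F.card : ℝ) * ‖∑ i ∈ I, c i * m i‖ = ‖(F.card : ℂ) * ∑ i ∈ I, c i * m i‖ := by
            rw [norm_mul, Complex.norm_natCast]
        _ ≤ ‖T‖ * (F.card * ‖x‖ ^ 2) + F.card * (ε * C) := by
            rw [hsplit]; exact (norm_add_le _ _).trans (add_le_add hbound hdiff)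
        _ = _ := by ring
    exact le_of_mul_le_mul_left hfin hcard
  refine le_of_forall_pos_le_add fun δ hδ => (main (δ / (C + 1)) (by positivity)).trans ?_
  have : δ / (C + 1) * C ≤ δ := by
    rw [div_mul_eq_mul_div, div_le_iff₀ (by positivity)]
    nlinarith
  linarith

end Comparison

section Span

variable {M : Type*} [AddCancelCommMonoid M] [LinearOrder M] [CanonicallyOrderedAdd M]
variable {A : Type*} [Ring A] [StarRing A] [Algebra ℂ A] [StarModule ℂ A] {v : M → A}

/-- The star algebra generated by isometries representing a totally ordered semigroup is spanned
by the products `v a * star (v b)`, since `star (v b) * v c` is `v (c - b)` or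
`star (v (b - c))`. -/
theorem mem_span_of_mem_adjoin (hadd : ∀ a b, v (a + b) = v a * v b)
    (hvv : ∀ a, star (v a) * v a = 1) {z : A} (hz : z ∈ StarAlgebra.adjoin ℂ (Set.range v)) :
    z ∈ Submodule.span ℂ (Set.range fun i : M × M => v i.1 * star (v i.2)) := by
  have h0 : v 0 = 1 := by
    calc v 0 = star (v 0) * v 0 * v 0 := by rw [hvv, one_mul]
      _ = star (v 0) * v (0 + 0) := by rw [mul_assoc, ← hadd]
      _ = 1 := by rw [add_zero, hvv]
  set B := Submodule.span ℂ (Set.range fun i : M × M => v i.1 * star (v i.2)) with hB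
  have hgen : ∀ a b, v a * star (v b) ∈ B := fun a b => Submodule.subset_span ⟨(a, b), rfl⟩
  have hmul : B * B ≤ B := by
    rw [hB, Submodule.span_mul_span, Submodule.span_le]
    rintro _ ⟨_, ⟨⟨a, b⟩, rfl⟩, _, ⟨⟨c, d⟩, rfl⟩, rfl⟩
    rcases le_total b c with h | h
    · obtain ⟨e, rfl⟩ := exists_add_of_le h
      have : v a * star (v b) * (v (b + e) * star (v d)) = v (a + e) * star (v d) := by
        calc _ = v a * (star (v b) * v b) * v e * star (v d) := by
              rw [hadd]; simp only [mul_assoc]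
          _ = _ := by rw [hvv, mul_one, hadd]
      exact Eq.subst (motive := (· ∈ B)) this.symm (hgen _ _)
    · obtain ⟨e, rfl⟩ := exists_add_of_le h
      have : v a * star (v (c + e)) * (v c * star (v d)) = v a * star (v (d + e)) := by
        calc _ = v a * star (v e) * (star (v c) * v c) * star (v d) := by
              rw [hadd, star_mul]; simp only [mul_assoc]
          _ = _ := by rw [hvv, mul_one, hadd, star_mul, mul_assoc]
      exact Eq.subst (motive := (· ∈ B)) this.symm (hgen _ _)
  induction hz using StarAlgebra.adjoin_induction with
  | mem x hx =>
    obtain ⟨a, rfl⟩ := hx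
    simpa [h0] using hgen a 0
  | algebraMap r =>
    rw [Algebra.algebraMap_eq_smul_one]
    exact B.smul_mem r (by simpa [h0] using hgen 0 0)
  | add x y _ _ hx hy => exact B.add_mem hx hy
  | mul x y _ _ hx hy => exact hmul (Submodule.mul_mem_mul hx hy)
  | star x _ hx =>
    refine Submodule.span_induction ?_ ?_ ?_ ?_ hx
    · rintro _ ⟨⟨a, b⟩, rfl⟩
      simpa using hgen b a
    · simp
    · intro x y _ _ hx hy
      rw [star_add]; exact B.add_mem hx hy
    · intro r x _ hx
      rw [star_smul]; exact B.smul_mem _ hx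

end Span

section Order

variable {G : Type u} [AddCommGroup G] {S : AddSubmonoid G}

/-- The order of a totally ordered semigroup: `x ≤ y` when `y - x` belongs to the semigroup. -/
theorem IsTotallyOrdered.exists_linearOrder (h : IsTotallyOrdered S) :
    ∃ _ : LinearOrder S, CanonicallyOrderedAdd S := by
  classical
  obtain ⟨K, hK, hinter⟩ := h
  have htot : ∀ x y : S, (y : G) - x ∈ S ∨ (x : G) - y ∈ S := by
    intro x y
    have hx : (x : G) ∈ K := by
      change (x : G) ∈ (K : Set G); rw [hK]; exact Or.inl x.2
    have hy : (y : G) ∈ K := by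
      change (y : G) ∈ (K : Set G); rw [hK]; exact Or.inl y.2
    have hxy : (y : G) - x ∈ (K : Set G) := K.sub_mem hy hx
    rw [hK] at hxy
    rcases hxy with hxy | hxy
    · exact Or.inl hxy
    · refine Or.inr ?_
      have : -((y : G) - x) ∈ S := hxy
      rwa [neg_sub] at this
  let o : LinearOrder S :=
    { le := fun x y => (y : G) - x ∈ S
      le_refl := fun x => by rw [sub_self]; exact S.zero_mem
      le_trans := fun x y z hxy hyz => by
        have := S.add_mem hyz hxy
        rwa [sub_add_sub_cancel] at this
      le_antisymm := fun x y hxy hyx => by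
        have hmem : (y : G) - x ∈ (S : Set G) ∩ -(S : Set G) :=
          ⟨hxy, by rw [Set.mem_neg, neg_sub]; exact hyx⟩
        rw [hinter] at hmem
        exact Subtype.ext (sub_eq_zero.1 hmem).symm
      le_total := htot
      toDecidableLE := Classical.decRel _ }
  have hle : ∀ x y : S, o.le x y ↔ (y : G) - x ∈ S := fun _ _ => Iff.rfl
  refine ⟨o, ?_⟩
  exact
    { exists_add_of_le := fun {x y} hxy => ⟨⟨(y : G) - x, hxy⟩, Subtype.ext (by simp)⟩
      le_self_add := fun x y => (hle _ _).2 (by simp)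
      le_add_self := fun x y => (hle _ _).2 (by simp) }

end Order

/-! ### Evaluation at the regular representation of a totally ordered semigroup -/

section Isomorphism

/-- A star homomorphism from a generated C*-algebra that preserves the norm on the star algebra
spanned by words in the generators is an isomorphism onto the C*-algebra generated by the images
of the generators. -/
theorem nonempty_equiv_generatedCStar {ι A B : Type*} [NormedRing A] [StarRing A]
    [CStarRing A] [NormedAlgebra ℂ A] [StarModule ℂ A] [CompleteSpace A] [NormedRing B]
    [StarRing B] [CStarRing B] [NormedAlgebra ℂ B] [StarModule ℂ B] {v : ι → A} {u : ι → B}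
    (w : generatedCStar v →⋆ₐ[ℂ] B) (hw : Continuous w) (g : ι → generatedCStar v)
    (hg : ∀ i, (g i : A) = v i) (hgu : ∀ i, w (g i) = u i)
    (hnorm : ∀ z : generatedCStar v, (z : A) ∈ StarAlgebra.adjoin ℂ (Set.range v) →
      ‖w z‖ = ‖z‖) :
    Nonempty (generatedCStar v ≃⋆ₐ[ℂ] generatedCStar u) := by
  have hiso : Isometry w := AddMonoidHomClass.isometry_of_norm w fun z =>
    (dense_adjoin v).induction (P := fun z : generatedCStar v => ‖w z‖ = ‖z‖) hnorm
      (isClosed_eq hw.norm continuous_norm) z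
  have hmem : ∀ z, w z ∈ generatedCStar u := by
    refine generatedCStar_induction (P := fun z => w z ∈ generatedCStar u) g hg
      (fun i => ?_) (fun r => ?_) (fun x y hx hy => ?_) (fun x y hx hy => ?_) (fun x hx => ?_) ?_
    · rw [hgu]
      exact StarSubalgebra.le_topologicalClosure _ (StarAlgebra.subset_adjoin ℂ _ ⟨i, rfl⟩)
    · rw [AlgHomClass.commutes]; exact algebraMap_mem _ r
    · rw [map_add]; exact add_mem hx hy
    · rw [map_mul]; exact mul_mem hx hy
    · rw [map_star]; exact star_mem hx
    · exact (StarSubalgebra.isClosed_topologicalClosure _).preimage hw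
  have hclosed : IsClosed (w.range : Set B) := by
    have : CompleteSpace (generatedCStar v) :=
      (StarSubalgebra.isClosed_topologicalClosure _).completeSpace_coe
    exact hiso.isClosedEmbedding.isClosed_range
  have hle : generatedCStar u ≤ w.range := by
    refine StarSubalgebra.topologicalClosure_minimal ?_ hclosed
    rw [StarAlgebra.adjoin_le_iff]
    rintro _ ⟨i, rfl⟩
    exact ⟨g i, hgu i⟩
  refine ⟨StarAlgEquiv.ofBijective (w.codRestrict _ hmem) ⟨fun x y hxy => ?_, fun T => ?_⟩⟩
  · exact hiso.injective (congrArg Subtype.val hxy)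
  · obtain ⟨z, hz⟩ := hle T.2
    exact ⟨z, Subtype.ext hz⟩

end Isomorphism

section Regular

open ContinuousLinearMap

variable {G : Type u} [AddCommGroup G] {S : AddSubmonoid G}

theorem star_regularOp_basisVec_add (p c : S) :
    star (regularOp p) (basisVec (p + c) : L2 S) = basisVec c := by
  classical
  have h : regularOp p (basisVec c : L2 S) = basisVec (p + c) := by
    rw [basisVec, basisVec, regularOp_apply]
    convert regularShift_single p c 1
  rw [← h, ← mul_apply_eq_comp, star_regularOp_mul_self, one_apply_eq_self]

/-- `V_p^* δ_r` is `δ_{r - p}` when `p ≤ r`, and zero otherwise. -/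
theorem inner_star_regularOp_basisVec [LinearOrder S] [CanonicallyOrderedAdd S] (p q r : S) :
    (inner ℂ (star (regularOp p) (basisVec r : L2 S))
        (star (regularOp q) (basisVec r : L2 S)) : ℂ) =
      if p = q ∧ p ≤ r then 1 else 0 := by
  have hzero : ∀ p : S, ¬ p ≤ r → star (regularOp p) (basisVec r : L2 S) = 0 := by
    intro p hp
    ext c
    rw [star_regularOp_apply, basisVec_apply, if_neg]
    · rfl
    · rintro rfl
      exact hp le_self_add
  by_cases hp : p ≤ r
  · by_cases hq : q ≤ r
    · obtain ⟨c, hc⟩ := exists_add_of_le hp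
      obtain ⟨c', hc'⟩ := exists_add_of_le hq
      have h1 : star (regularOp p) (basisVec r : L2 S) = basisVec c := by
        rw [hc, star_regularOp_basisVec_add]
      have h2 : star (regularOp q) (basisVec r : L2 S) = basisVec c' := by
        rw [hc', star_regularOp_basisVec_add]
      rw [h1, h2, inner_basisVec]
      have hiff : c = c' ↔ p = q := by
        constructor
        · rintro rfl
          exact add_right_cancel (hc.symm.trans hc')
        · rintro rfl
          exact add_left_cancel (hc.symm.trans hc')
      simp [hiff, hp]
    · rw [hzero q hq, inner_zero_right, if_neg]
      rintro ⟨rfl, h⟩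
      exact hq h
  · rw [hzero p hp, inner_zero_left, if_neg fun h => hp h.2]

variable (S) in
/-- The regular representation of `S` on `ℓ²(S)`. -/
noncomputable def regRep : IsometricRep S where
  space := L2 S
  nontrivial := ⟨basisVec 0, 0, fun h => by
    have h1 := congrArg (fun f : L2 S => f 0) h
    simp [basisVec_apply] at h1⟩
  V := regularOp
  isometry a := (regularShift a).isometry
  map_add := regularOp_add

theorem star_universalIsometry_mul_self (a : S) :
    star (universalIsometry S a) * universalIsometry S a = 1 :=
  lp.ext <| funext fun ρ => star_mul_self_of_isometry (ρ.isometry a)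

theorem universalIsometry_add (a b : S) :
    universalIsometry S (a + b) = universalIsometry S a * universalIsometry S b :=
  lp.ext <| funext fun ρ => ρ.map_add a b

theorem norm_inner_evalRep_le (hS : IsTotallyOrdered S) {z : RepProduct S}
    (hz : z ∈ StarAlgebra.adjoin ℂ (Set.range (universalIsometry S))) (ρ : IsometricRep S)
    (x : ρ.space) :
    ‖(inner ℂ x (evalRep ρ z x) : ℂ)‖ ≤ ‖evalRep (regRep S) z‖ * ‖x‖ ^ 2 := by
  obtain ⟨_, _⟩ := hS.exists_linearOrder
  obtain ⟨c, hc⟩ := Finsupp.mem_span_range_iff_exists_finsupp.1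
    (mem_span_of_mem_adjoin universalIsometry_add star_universalIsometry_mul_self hz)
  have hev : ∀ σ : IsometricRep S,
      evalRep σ z = ∑ i ∈ c.support, c i • (σ.V i.1 * star (σ.V i.2)) := by
    intro σ
    rw [← hc, Finsupp.sum, map_sum]
    refine Finset.sum_congr rfl fun i _ => ?_
    rw [map_smul, map_mul, map_star]
    rfl
  rw [hev ρ, hev (regRep S)]
  exact norm_inner_sum_monomial_le ρ.map_add (fun a => star_mul_self_of_isometry (ρ.isometry a))
    regularOp_add inner_star_regularOp_basisVec c.support c x

/-- Over a totally ordered semigroup the regular representation attains the norm of every element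
of the star algebra generated by the universal isometries. -/
theorem norm_evalRep_regRep (hS : IsTotallyOrdered S) {z : RepProduct S}
    (hz : z ∈ StarAlgebra.adjoin ℂ (Set.range (universalIsometry S))) :
    ‖evalRep (regRep S) z‖ = ‖z‖ := by
  refine le_antisymm (norm_evalRep_le _ _) (lp.norm_le_of_forall_le (norm_nonneg _) fun ρ => ?_)
  refine opNorm_le_bound _ (norm_nonneg _) fun x => ?_
  have h := norm_inner_evalRep_le hS (mul_mem (star_mem hz) hz) ρ x
  have h1 : (inner ℂ x (evalRep ρ (star z * z) x) : ℂ) = inner ℂ (z ρ x) (z ρ x) := by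
    rw [map_mul, map_star, mul_apply_eq_comp, star_eq_adjoint, adjoint_inner_right]
    rfl
  have h2 : ‖(inner ℂ (z ρ x) (z ρ x) : ℂ)‖ = ‖z ρ x‖ ^ 2 := by
    rw [inner_self_eq_norm_sq_to_K, norm_pow, RCLike.norm_ofReal, abs_norm]
  have h3 : ‖evalRep (regRep S) (star z * z)‖ = ‖evalRep (regRep S) z‖ ^ 2 := by
    rw [map_mul, map_star, CStarRing.norm_star_mul_self, sq]
  rw [h1, h2, h3, ← mul_pow] at h
  exact le_of_sq_le_sq h (by positivity)

/-- Over a totally ordered semigroup, evaluation at the regular representation is an isomorphism. -/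
theorem nonempty_equiv (hS : IsTotallyOrdered S) :
    Nonempty (UniversalCStar S ≃⋆ₐ[ℂ] ReducedCStar S) :=
  nonempty_equiv_generatedCStar (B := L2 S →L[ℂ] L2 S) (evalUniversal S (regRep S))
    (continuous_evalUniversal _) (universalGen S) (fun _ => rfl) (fun _ => rfl)
    fun _ hz => norm_evalRep_regRep hS hz

end Regular

/-! ### The semigroup `{0, 2, 3, …}` -/

theorem containsNoGroup_natWithoutOne : ContainsNoGroup natWithoutOne := by
  ext n
  simp only [Set.mem_inter_iff, Set.mem_neg, Set.mem_singleton_iff]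
  constructor
  · rintro ⟨h1, h2⟩
    have h1' : 0 ≤ n ∧ n ≠ 1 := h1
    have h2' : 0 ≤ -n ∧ -n ≠ 1 := h2
    omega
  · rintro rfl
    exact ⟨natWithoutOne.zero_mem, by rw [neg_zero]; exact natWithoutOne.zero_mem⟩

theorem not_isTotallyOrdered_natWithoutOne : ¬ IsTotallyOrdered natWithoutOne := by
  rintro ⟨H, hH, -⟩
  have hmem : ∀ n : ℤ, 0 ≤ n ∧ n ≠ 1 → n ∈ H := fun n hn => by
    have : n ∈ (H : Set ℤ) := by rw [hH]; exact Or.inl hn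
    exact this
  have h1 : (3 - 2 : ℤ) ∈ (H : Set ℤ) := H.sub_mem (hmem 3 (by norm_num)) (hmem 2 (by norm_num))
  rw [hH] at h1
  rcases h1 with h | h
  · have h' : (0 : ℤ) ≤ 3 - 2 ∧ (3 - 2 : ℤ) ≠ 1 := h
    omega
  · have h' : (0 : ℤ) ≤ -(3 - 2) ∧ -(3 - 2 : ℤ) ≠ 1 := h
    omega

end SemigroupCStar

theorem mainTheorem2 :
    (∀ (G : Type u) [AddCommGroup G] [IsAddTorsionFree G] (S : AddSubmonoid G),
      SemigroupCStar.ContainsNoGroup S →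
        (Nonempty (SemigroupCStar.UniversalCStar S ≃⋆ₐ[ℂ] SemigroupCStar.ReducedCStar S) ↔
          SemigroupCStar.IsTotallyOrdered S)) ∧
    IsEmpty (SemigroupCStar.UniversalCStar SemigroupCStar.natWithoutOne ≃⋆ₐ[ℂ]
      SemigroupCStar.ReducedCStar SemigroupCStar.natWithoutOne) :=
  ⟨fun _ _ _ _ hS => ⟨fun ⟨Φ⟩ => SemigroupCStar.isTotallyOrdered_of_equiv hS Φ,
    SemigroupCStar.nonempty_equiv⟩,
  ⟨fun Φ => SemigroupCStar.not_isTotallyOrdered_natWithoutOne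
    (SemigroupCStar.isTotallyOrdered_of_equiv SemigroupCStar.containsNoGroup_natWithoutOne Φ)⟩⟩
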